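/- Let $(M^m,g)$ be a connected smooth Riemannian manifold (without boundary) of dimension $m\ge 1$, let $\Delta=\operatorname{div}\nabla$ be its Laplace operator, acting componentwise on $\mathbb R^{n+1}$-valued functions, and let $\phi:(M^m,g)\to\mathbb R^{n+1}$ be a smooth isometric immersion with $$\Delta^2\phi=-\mu\,\Delta\phi$$ for some function $\mu$ on $M$. Suppose that $\phi$ realizes a biharmonic submanifold of the unit sphere $S^n\subset\mathbb R^{n+1}$, that is, $\phi(M)\subset S^n$ and $\phi:M\to S^n$ is a critical point, under all compactly supported smooth variations through maps $M\to S^n$, of the bienergy $E_2(\phi)=\frac12\int_M|\tau(\phi)|^2\,dv_g$, where $\tau(\phi)=\operatorname{Tr}_g\nabla d\phi$ is the tension field of $\phi:M\to S^n$. Let $\eta=\frac1m\operatorname{Tr}_g\nabla d\phi$ be the mean curvature vector field of $\phi:M\to S^n$. Then one of the following holds. 1. The submanifold $\phi:M\to S^n$ is minimal (that is, $\eta\equiv0$), and $\mu=m$ on $M$. 2. $\mu=2m$ on $M$, the submanifold has constant mean curvature $|\eta|=1$, and, up to an isometry of $S^n$, it is the composition of a minimal submanifold $\psi:M^m\to S^{n-1}(1/\sqrt2)$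 followed by the standard biharmonic isometric immersion $S^{n-1}(1/\sqrt2)\to S^n$, $x\mapsto(x,1/\sqrt2)$: there are a minimal isometric immersion $\psi:(M,g)\to S^{n-1}(1/\sqrt2)\subset\mathbb R^n$ and $A\in O(n+1)$ with $\phi(p)=A(\psi(p),1/\sqrt2)$ for all $p\in M$. In particular, if the biharmonic submanifold is proper (not minimal), then $\mu=2m$, $|\eta|=1$, and it is such a composition. -/

import Mathlib

open scoped Manifold ContDiff

noncomputable section

namespace Biharm

open MeasureTheory

/-- Euclidean space `ℝ^d` with its Euclidean norm. -/
abbrev Euc (d : ℕ) : Type := EuclideanSpace ℝ (Fin d)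

/-- A smooth Riemannian metric on a manifold `M` of dimension `m`. -/
abbrev Metric (m : ℕ) (M : Type*) [TopologicalSpace M] [ChartedSpace (Euc m) M]
    [IsManifold (𝓡 m) ∞ M] : Type _ :=
  Bundle.ContMDiffRiemannianMetric (𝓡 m) ∞ (Euc m) (fun x : M => TangentSpace (𝓡 m) x)

/-- The `i`-th partial derivative of a map on `ℝ^m`. -/
def pd {m : ℕ} {F : Type*} [NormedAddCommGroup F] [NormedSpace ℝ F]
    (i : Fin m) (f : Euc m → F) (y : Euc m) : F :=
  fderiv ℝ f y (EuclideanSpace.single i 1)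

section Riemannian

variable {m : ℕ} {M : Type*} [TopologicalSpace M] [ChartedSpace (Euc m) M]
  [IsManifold (𝓡 m) ∞ M]

/-- The coordinate vector field `∂_i` of the chart `c`, at the point of coordinates `y`. -/
def coordVec (c : OpenPartialHomeomorph M (Euc m)) (y : Euc m) (i : Fin m) :
    TangentSpace (𝓡 m) (c.symm y) :=
  mfderiv (𝓡 m) (𝓡 m) c.symm y (EuclideanSpace.single i (1 : ℝ) : Euc m)

/-- The matrix `g_{ij}` of the metric in the chart `c`. -/
def gram (g : Metric m M) (c : OpenPartialHomeomorph M (Euc m)) (y : Euc m) :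
    Matrix (Fin m) (Fin m) ℝ :=
  Matrix.of fun i j => g.inner (c.symm y) (coordVec c y i) (coordVec c y j)

/-- The density `√det g` of the Riemannian volume in the chart `c`. -/
def volDensity (g : Metric m M) (c : OpenPartialHomeomorph M (Euc m)) (y : Euc m) : ℝ :=
  √(gram g c y).det

/-- The Christoffel symbol `Γ^k_{ij}` of the Levi-Civita connection of `g` in the chart `c`. -/
def christoffel (g : Metric m M) (c : OpenPartialHomeomorph M (Euc m)) (k i j : Fin m)
    (y : Euc m) : ℝ :=
  (1 / 2) * ∑ l, (gram g c y)⁻¹ k l *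
    (pd i (fun z => gram g c z j l) y + pd j (fun z => gram g c z i l) y
      - pd l (fun z => gram g c z i j) y)

/-- The Laplace operator `Δ f = div (∇ f) = (1/√det g) ∂_i (√det g · g^{ij} ∂_j f)`, acting
componentwise on vector valued functions. -/
def laplacian {F : Type*} [NormedAddCommGroup F] [NormedSpace ℝ F]
    (g : Metric m M) (f : M → F) (p : M) : F :=
  let c := chartAt (Euc m) p
  (volDensity g c (c p))⁻¹ • ∑ i, pd i (fun z =>
    ∑ j, (volDensity g c z * (gram g c z)⁻¹ i j) • pd j (fun w => f (c.symm w)) z) (c p)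

/-- The part of the Riemannian volume carried by the domain of the chart around `p`, namely
`√det g dy` transported by the chart. -/
def chartVolume [MeasurableSpace M] (g : Metric m M) (p : M) : Measure M :=
  let c := chartAt (Euc m) p
  (((volume : Measure (Euc m)).restrict c.target).withDensity
    (fun y => ENNReal.ofReal (volDensity g c y))).map c.symm

/-- The Riemannian volume `dv_g`: the smallest measure on `M` that dominates the volumes of all
the charts. Since these agree on overlaps, its restriction to the domain of each chart is the
volume of that chart. -/
def riemannianVolume [MeasurableSpace M] (g : Metric m M) : Measure M :=
  ⨆ p : M, chartVolume g p

variable {F : Type*} [NormedAddCommGroup F] [InnerProductSpace ℝ F]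

/-- `φ : (M, g) → F` is a (smooth) isometric immersion into the Euclidean space `F`. -/
def IsIsometricImmersion (g : Metric m M) (φ : M → F) : Prop :=
  ContMDiff (𝓡 m) 𝓘(ℝ, F) ∞ φ ∧
    ∀ (p : M) (v w : TangentSpace (𝓡 m) p),
      inner (𝕜 := ℝ) (E := F) (mfderiv (𝓡 m) 𝓘(ℝ, F) φ p v) (mfderiv (𝓡 m) 𝓘(ℝ, F) φ p w)
        = g.inner p v w

/-- The orthogonal projection of `F` onto the tangent space `u^⊥` at `u` of the sphere centred at
the origin that passes through `u`. -/
def sphereProj (u : F) : F →L[ℝ] F := (ℝ ∙ u)ᗮ.starProjection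

/-- The component `(∇dφ)(∂_i, ∂_j) = ∇^φ_{∂_i} (dφ ∂_j) - dφ (∇_{∂_i} ∂_j)` of the second
fundamental form of a map `φ` from `(M, g)` into a sphere of `F` centred at the origin. The
Levi-Civita connection of the sphere is the tangential part of the flat connection of `F`. -/
def secondFundamentalForm (g : Metric m M) (φ : M → F) (c : OpenPartialHomeomorph M (Euc m))
    (i j : Fin m) (y : Euc m) : F :=
  sphereProj (φ (c.symm y)) (pd i (pd j (fun w => φ (c.symm w))) y)
    - ∑ k, christoffel g c k i j y • pd k (fun w => φ (c.symm w)) y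

/-- The tension field `τ(φ) = Tr_g ∇dφ` of a map `φ` from `(M, g)` into a sphere of `F` centred at
the origin. -/
def tension (g : Metric m M) (φ : M → F) (p : M) : F :=
  let c := chartAt (Euc m) p
  ∑ i, ∑ j, (gram g c (c p))⁻¹ i j • secondFundamentalForm g φ c i j (c p)

/-- The mean curvature vector field `η = (1/m) Tr_g ∇dφ` of an isometric immersion `φ` of `(M, g)`
into a sphere of `F` centred at the origin. -/
def meanCurvature (g : Metric m M) (φ : M → F) (p : M) : F :=
  (m : ℝ)⁻¹ • tension g φ p

/-- `φ` is a minimal isometric immersion of `(M, g)` into the sphere of radius `r` of `F`. -/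
def IsMinimalInSphere (g : Metric m M) (r : ℝ) (φ : M → F) : Prop :=
  IsIsometricImmersion g φ ∧ (∀ p, ‖φ p‖ = r) ∧ ∀ p, meanCurvature g φ p = 0

/-- The bienergy `(1/2) ∫_K |τ(φ)|² dv_g` over `K` of a map into a sphere. -/
def bienergy [MeasurableSpace M] (g : Metric m M) (K : Set M) (φ : M → F) : ℝ :=
  (1 / 2) * ∫ p in K, ‖tension g φ p‖ ^ 2 ∂(riemannianVolume g)

/-- `Φ` is a smooth variation of `φ`, through maps into the unit sphere of `F`, that is constant
outside `K`. -/
def IsSphereVariation (φ : M → F) (K : Set M) (Φ : ℝ → M → F) : Prop :=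
  ContMDiff (𝓘(ℝ, ℝ).prod (𝓡 m)) 𝓘(ℝ, F) ∞ (fun q : ℝ × M => Φ q.1 q.2) ∧
    (∀ t p, ‖Φ t p‖ = 1) ∧ (∀ p, Φ 0 p = φ p) ∧ ∀ t, ∀ p ∉ K, Φ t p = φ p

/-- `φ` is a biharmonic map from `(M, g)` into the unit sphere of `F`: a smooth map that is a
critical point of the bienergy with respect to all compactly supported variations. -/
def IsBiharmonicToSphere [MeasurableSpace M] (g : Metric m M) (φ : M → F) : Prop :=
  ContMDiff (𝓡 m) 𝓘(ℝ, F) ∞ φ ∧ (∀ p, ‖φ p‖ = 1) ∧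
    ∀ (K : Set M) (Φ : ℝ → M → F), IsCompact K → IsSphereVariation (m := m) φ K Φ →
      HasDerivAt (fun t => bienergy g K (Φ t)) 0 0

end Riemannian

/-- The standard inclusion `x ↦ (x, 1/√2)` of the sphere of radius `1/√2` of `ℝ^n` into the unit
sphere of `ℝ^{n+1}` (written on all of `ℝ^n`). -/
def standardInclusion (n : ℕ) (x : Euc n) : Euc (n + 1) :=
  WithLp.toLp 2 (Fin.snoc (α := fun _ => ℝ) x.ofLp (1 / √2))

end Biharm

end

/-! Let Δ be the Laplacian on ℝ^{n+1}-valued maps. Since |φ|² = 1 and φ is isometric, applying Δ to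
|φ|² gives ⟨Δφ, φ⟩ = -m, so Δφ = τ - mφ, with τ the tension field into the sphere. Applying Δ once
more, and using that Δφ is normal to the immersion, gives ⟨Δ²φ, φ⟩ = |Δφ|². The equation Δ²φ = -μΔφ
then yields |Δφ|² = mμ, hence |τ|² = m(μ - m).

The first variation of the bienergy says that Δ²φ + 2mΔφ has no component tangent to the sphere
(`sphereProj_bitension_eq_zero`). Here that vector is (2m - μ)Δφ, so (2m - μ)τ = 0. At each point
either τ = 0 and μ = m, or μ = 2m and |τ|² = m². The continuous function |τ|² takes only the values
0 and m², so connectedness selects one of the two cases on all of M.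

If μ = 2m everywhere, H = Δφ + 2mφ is harmonic of constant norm √2 m. Then 0 = Δ|H|² = 2|∇H|² and H
is constant (`isLocallyConstant_laplacian_add`). With e = H/|H| one finds ⟨φ, e⟩ = 1/√2, so φ lies
in a hyperplane section. Its orthogonal projection ψ to e^⊥ satisfies Δψ = -2mψ, which makes ψ
minimal in its sphere (`exists_minimal_of_hyperplane`).

The analysis takes place in charts. There the metric is g_ij = ⟨∂_i u, ∂_j u⟩ for the local
expression u of φ, so products ⟨∂_i∂_j u, ∂_l u⟩ replace the Christoffel symbols. Test fields for
the first variation are supported in one chart, so no partition of unity enters. -/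

open scoped Manifold ContDiff

noncomputable section

namespace Biharm

open MeasureTheory Filter Topology

/-! ### Calculus of partial derivatives on open subsets of ℝ^m. -/

section PartialDerivatives

variable {m : ℕ} {E F : Type*} [NormedAddCommGroup E] [NormedSpace ℝ E]
  [NormedAddCommGroup F] [InnerProductSpace ℝ F] {Ω : Set (Euc m)} {y : Euc m}

theorem pd_congr {f h : Euc m → E} (i : Fin m) (H : f =ᶠ[𝓝 y] h) : pd i f y = pd i h y := by
  simp [pd, H.fderiv_eq]

theorem pd_congr_on {f h : Euc m → E} (hΩ : IsOpen Ω) (H : Set.EqOn f h Ω) (i : Fin m) :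
    Set.EqOn (pd i f) (pd i h) Ω := fun _ hz =>
  pd_congr i (H.eventuallyEq_of_mem (hΩ.mem_nhds hz))

theorem pd_const (i : Fin m) (e : E) : pd i (fun _ : Euc m => e) y = 0 := by
  simp [pd]

theorem pd_add {f h : Euc m → E} (i : Fin m) (hf : DifferentiableAt ℝ f y)
    (hh : DifferentiableAt ℝ h y) : pd i (fun z => f z + h z) y = pd i f y + pd i h y := by
  simp [pd, fderiv_fun_add hf hh]

theorem pd_sub {f h : Euc m → E} (i : Fin m) (hf : DifferentiableAt ℝ f y)
    (hh : DifferentiableAt ℝ h y) : pd i (fun z => f z - h z) y = pd i f y - pd i h y := by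
  simp [pd, fderiv_fun_sub hf hh]

theorem pd_sum {ι : Type*} (s : Finset ι) {f : ι → Euc m → E} (i : Fin m)
    (hf : ∀ k ∈ s, DifferentiableAt ℝ (f k) y) :
    pd i (fun z => ∑ k ∈ s, f k z) y = ∑ k ∈ s, pd i (f k) y := by
  simp [pd, fderiv_fun_sum hf]

theorem pd_smul {a : Euc m → ℝ} {f : Euc m → E} (i : Fin m) (ha : DifferentiableAt ℝ a y)
    (hf : DifferentiableAt ℝ f y) :
    pd i (fun z => a z • f z) y = a y • pd i f y + pd i a y • f y := by
  simp [pd, fderiv_fun_smul ha hf]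

theorem pd_mul {a b : Euc m → ℝ} (i : Fin m) (ha : DifferentiableAt ℝ a y)
    (hb : DifferentiableAt ℝ b y) :
    pd i (fun z => a z * b z) y = a y * pd i b y + pd i a y * b y :=
  pd_smul i ha hb

theorem pd_inner {f h : Euc m → F} (i : Fin m) (hf : DifferentiableAt ℝ f y)
    (hh : DifferentiableAt ℝ h y) :
    pd i (fun z => inner ℝ (f z) (h z)) y
      = inner ℝ (f y) (pd i h y) + inner ℝ (pd i f y) (h y) := by
  simp [pd, fderiv_inner_apply ℝ hf hh]

theorem pd_clm {E' : Type*} [NormedAddCommGroup E'] [NormedSpace ℝ E'] (A : E →L[ℝ] E')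
    {f : Euc m → E} (i : Fin m) (hf : DifferentiableAt ℝ f y) :
    pd i (fun z => A (f z)) y = A (pd i f y) := by
  have := (A.hasFDerivAt.comp y hf.hasFDerivAt).fderiv
  simp only [pd]
  change fderiv ℝ (A ∘ f) y _ = _
  rw [this]; rfl

theorem _root_.ContDiffOn.pd {f : Euc m → E} (hf : ContDiffOn ℝ ∞ f Ω) (hΩ : IsOpen Ω)
    (i : Fin m) : ContDiffOn ℝ ∞ (pd i f) Ω :=
  (hf.fderiv_of_isOpen hΩ (m := ∞) (by simp)).clm_apply contDiffOn_const

theorem _root_.ContDiffOn.diffAt {f : Euc m → E} (hf : ContDiffOn ℝ ∞ f Ω) (hΩ : IsOpen Ω)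
    (hy : y ∈ Ω) : DifferentiableAt ℝ f y :=
  (hf.contDiffAt (hΩ.mem_nhds hy)).differentiableAt (by simp)

theorem pd_pd_comm {f : Euc m → E} (hf : ContDiffOn ℝ ∞ f Ω) (hΩ : IsOpen Ω) (hy : y ∈ Ω)
    (i j : Fin m) : pd i (pd j f) y = pd j (pd i f) y := by
  have h1 : ContDiffAt ℝ ∞ f y := hf.contDiffAt (hΩ.mem_nhds hy)
  have h2 := h1.isSymmSndFDerivAt (by simp only [minSmoothness_of_isRCLikeNormedField]; norm_cast)
  have h3 : DifferentiableAt ℝ (fderiv ℝ f) y :=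
    (h1.fderiv_right (m := 1) (by norm_cast)).differentiableAt (by simp)
  have key : ∀ i j : Fin m, pd i (pd j f) y
      = fderiv ℝ (fderiv ℝ f) y (EuclideanSpace.single i 1) (EuclideanSpace.single j 1) := by
    intro i j
    change fderiv ℝ (fun z => fderiv ℝ f z (EuclideanSpace.single j 1)) y _ = _
    rw [fderiv_clm_apply h3 (differentiableAt_const _)]
    simp
  rw [key, key, h2.eq]

/-- Chain rule for the partial derivatives. -/
theorem pd_comp {f : Euc m → E} {T : Euc m → Euc m} (i : Fin m)
    (hf : DifferentiableAt ℝ f (T y)) (hT : DifferentiableAt ℝ T y) :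
    pd i (fun z => f (T z)) y = ∑ a, (pd i T y) a • pd a f (T y) := by
  have h := (hf.hasFDerivAt.comp y hT.hasFDerivAt).fderiv
  have e : ∀ v : Euc m, v = ∑ a, v a • (EuclideanSpace.single a (1 : ℝ) : Euc m) := by
    intro v
    ext k
    simp [Pi.single_apply]
  simp only [pd]
  change fderiv ℝ (f ∘ T) y _ = _
  rw [h, ContinuousLinearMap.comp_apply]
  conv_lhs => rw [e (fderiv ℝ T y (EuclideanSpace.single i 1))]
  simp [map_sum]

theorem contDiffOn_entry {T : Euc m → Euc m} (hT : ContDiffOn ℝ ∞ T Ω) (a : Fin m) :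
    ContDiffOn ℝ ∞ (fun z => T z a) Ω :=
  (EuclideanSpace.proj (𝕜 := ℝ) a).contDiff.comp_contDiffOn hT

end PartialDerivatives

/-! ### Derivatives of determinants and inverse matrices. -/

section MatrixCalculus

variable {m : ℕ} {Ω : Set (Euc m)} {y : Euc m} {k : ℕ}

theorem contDiffOn_det {X : Euc m → Matrix (Fin k) (Fin k) ℝ}
    (hX : ∀ a b, ContDiffOn ℝ ∞ (fun z => X z a b) Ω) :
    ContDiffOn ℝ ∞ (fun z => (X z).det) Ω := by
  simp only [Matrix.det_apply']
  exact ContDiffOn.sum fun σ _ => contDiffOn_const.mul (contDiffOn_prod fun a _ => hX _ _)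

theorem contDiffOn_inv {X : Euc m → Matrix (Fin k) (Fin k) ℝ}
    (hX : ∀ a b, ContDiffOn ℝ ∞ (fun z => X z a b) Ω) (h0 : ∀ z ∈ Ω, (X z).det ≠ 0)
    (a b : Fin k) : ContDiffOn ℝ ∞ (fun z => (X z)⁻¹ a b) Ω := by
  have : ContDiffOn ℝ ∞ (fun z => ((X z).det)⁻¹ * (X z).adjugate a b) Ω := by
    refine ((contDiffOn_det hX).inv h0).mul ?_
    simp only [Matrix.adjugate_apply]
    refine contDiffOn_det fun c d => ?_
    by_cases hc : c = b
    · subst hc; simp only [Matrix.updateRow_self]; exact contDiffOn_const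
    · simp only [Matrix.updateRow_ne hc]; exact hX c d
  refine this.congr fun z _ => ?_
  simp [Matrix.inv_def]

/-- Jacobi's formula for the derivative of a determinant. -/
theorem pd_det {X : Euc m → Matrix (Fin k) (Fin k) ℝ} (i : Fin m)
    (hX : ∀ a b, DifferentiableAt ℝ (fun z => X z a b) y) :
    pd i (fun z => (X z).det) y
      = ∑ a, ∑ b, (X y).adjugate b a * pd i (fun z => X z a b) y := by
  -- As a multilinear function of the rows, the determinant has a derivative that replaces one row
  -- at a time; Cramer's rule writes each such term with the adjugate.
  let D : ContinuousMultilinearMap ℝ (fun _ : Fin k => Fin k → ℝ) ℝ :=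
    ⟨(Matrix.detRowAlternating (n := Fin k) (R := ℝ)).toMultilinearMap,
      Continuous.matrix_det (A := fun v : Fin k → Fin k → ℝ => (v : Matrix (Fin k) (Fin k) ℝ))
        continuous_id⟩
  have hD : ∀ z, (X z).det = D (fun a b => X z a b) := fun z => rfl
  have h1 : HasFDerivAt (fun z => (fun a b => X z a b : Fin k → Fin k → ℝ))
      (ContinuousLinearMap.pi fun a => ContinuousLinearMap.pi fun b =>
        fderiv ℝ (fun z => X z a b) y) y :=
    hasFDerivAt_pi.2 fun a => hasFDerivAt_pi.2 fun b => (hX a b).hasFDerivAt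
  have h2 := (D.hasFDerivAt (fun a b => X y a b)).comp y h1
  have h3 : fderiv ℝ (fun z => (X z).det) y = _ := h2.fderiv
  simp only [pd]
  rw [h3, ContinuousLinearMap.comp_apply, ContinuousMultilinearMap.linearDeriv_apply]
  refine Finset.sum_congr rfl fun a _ => ?_
  have h4 : ∀ w : Fin k → ℝ, D (Function.update (fun a b => X y a b) a w)
      = ∑ b, (X y).adjugate b a * w b := by
    intro w
    have : D (Function.update (fun a b => X y a b) a w) = ((X y).updateRow a w).det := rfl
    rw [this, ← Matrix.cramer_transpose_apply, Matrix.cramer_eq_adjugate_mulVec]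
    simp [Matrix.mulVec, dotProduct, ← Matrix.adjugate_transpose]
  exact h4 _

/-- Differentiate X X⁻¹ = 1 and solve for the derivative of X⁻¹. -/
theorem pd_inv {X : Euc m → Matrix (Fin k) (Fin k) ℝ} (hΩ : IsOpen Ω) (hy : y ∈ Ω) (i : Fin m)
    (hX : ∀ a b, ContDiffOn ℝ ∞ (fun z => X z a b) Ω) (h0 : ∀ z ∈ Ω, (X z).det ≠ 0)
    (a b : Fin k) :
    pd i (fun z => (X z)⁻¹ a b) y
      = -∑ c, ∑ d, (X y)⁻¹ a c * pd i (fun z => X z c d) y * (X y)⁻¹ d b := by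
  have hI := contDiffOn_inv hX h0
  set D : Matrix (Fin k) (Fin k) ℝ := Matrix.of fun a b => pd i (fun z => X z a b) y with hD
  set N : Matrix (Fin k) (Fin k) ℝ := Matrix.of fun a b => pd i (fun z => (X z)⁻¹ a b) y with hN
  have hu : ∀ z ∈ Ω, IsUnit (X z).det := fun z hz => (h0 z hz).isUnit
  have key : X y * N + D * (X y)⁻¹ = 0 := by
    ext c d
    have h1 : pd i (fun z => ∑ e, X z c e * (X z)⁻¹ e d) y = 0 := by
      rw [← pd_const (y := y) i ((1 : Matrix (Fin k) (Fin k) ℝ) c d)]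
      refine pd_congr i ?_
      filter_upwards [hΩ.mem_nhds hy] with z hz
      rw [← Matrix.mul_apply, Matrix.mul_nonsing_inv _ (hu z hz)]
    rw [pd_sum _ _ fun e _ => ((hX c e).mul (hI e d)).diffAt hΩ hy] at h1
    refine Eq.trans ?_ h1
    simp only [Matrix.add_apply, Matrix.mul_apply, ← Finset.sum_add_distrib]
    refine Finset.sum_congr rfl fun e _ => ?_
    rw [pd_mul _ ((hX c e).diffAt hΩ hy) ((hI e d).diffAt hΩ hy)]
    simp [hD, hN]
  have h2 : N = -((X y)⁻¹ * D * (X y)⁻¹) := by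
    have : (X y)⁻¹ * (X y * N + D * (X y)⁻¹) = 0 := by rw [key, mul_zero]
    rw [mul_add, Matrix.nonsing_inv_mul_cancel_left _ _ (hu y hy), ← mul_assoc] at this
    exact eq_neg_of_add_eq_zero_left this
  have h3 := congrFun (congrFun h2 a) b
  simp only [hN, Matrix.of_apply] at h3
  rw [h3]
  simp only [Matrix.neg_apply, Matrix.mul_apply, Finset.sum_mul, hD, Matrix.of_apply]
  rw [Finset.sum_comm]

end MatrixCalculus

/-! ### The Laplacian of an induced metric in coordinates. -/

section CoordinateLaplacian

variable {m : ℕ} {E F : Type*} [NormedAddCommGroup E] [NormedSpace ℝ E]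
  [NormedAddCommGroup F] [InnerProductSpace ℝ F] {Ω : Set (Euc m)} {y : Euc m}

/-- The Laplace operator of the metric with matrix `G` on an open set of `ℝ^m`. -/
def coordLaplacian (G : Euc m → Matrix (Fin m) (Fin m) ℝ) (f : Euc m → E) (y : Euc m) : E :=
  (√(G y).det)⁻¹ • ∑ i, pd i (fun z => ∑ j, (√(G z).det * (G z)⁻¹ i j) • pd j f z) y

/-- The coefficient of `∂_j` in the Laplace operator of the metric with matrix `G`. -/
def drift (G : Euc m → Matrix (Fin m) (Fin m) ℝ) (j : Fin m) (y : Euc m) : ℝ :=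
  (√(G y).det)⁻¹ * ∑ i, pd i (fun z => √(G z).det * (G z)⁻¹ i j) y

/-- On the open set `Ω`, the matrix `G` is that of the metric induced by the immersion `u`. -/
structure IsInducedMetric (Ω : Set (Euc m)) (u : Euc m → F)
    (G : Euc m → Matrix (Fin m) (Fin m) ℝ) : Prop where
  isOpen : IsOpen Ω
  smooth : ContDiffOn ℝ ∞ u Ω
  gram_eq : ∀ y ∈ Ω, ∀ i j, G y i j = inner ℝ (pd i u y) (pd j u y)
  posDef : ∀ y ∈ Ω, (G y).PosDef

namespace IsInducedMetric

variable {u : Euc m → F} {G : Euc m → Matrix (Fin m) (Fin m) ℝ} (hG : IsInducedMetric Ω u G)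

include hG

theorem contDiffOn_gram (a b : Fin m) : ContDiffOn ℝ ∞ (fun z => G z a b) Ω :=
  ((hG.smooth.pd hG.isOpen a).inner ℝ (hG.smooth.pd hG.isOpen b)).congr
    fun z hz => hG.gram_eq z hz a b

theorem det_pos (hy : y ∈ Ω) : 0 < (G y).det := (hG.posDef y hy).det_pos

theorem contDiffOn_inv (a b : Fin m) : ContDiffOn ℝ ∞ (fun z => (G z)⁻¹ a b) Ω :=
  Biharm.contDiffOn_inv hG.contDiffOn_gram (fun _ hz => (hG.det_pos hz).ne') a b

theorem contDiffOn_density : ContDiffOn ℝ ∞ (fun z => √(G z).det) Ω :=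
  (contDiffOn_det hG.contDiffOn_gram).sqrt fun _ hz => (hG.det_pos hz).ne'

theorem density_pos (hy : y ∈ Ω) : 0 < √(G y).det := Real.sqrt_pos.2 (hG.det_pos hy)

theorem gram_symm (hy : y ∈ Ω) (a b : Fin m) : G y a b = G y b a := by
  rw [hG.gram_eq y hy, hG.gram_eq y hy, real_inner_comm]

theorem inv_symm (hy : y ∈ Ω) (a b : Fin m) : (G y)⁻¹ a b = (G y)⁻¹ b a := by
  have h : (G y).transpose = G y := Matrix.ext fun i j => hG.gram_symm hy j i
  have : (G y)⁻¹.transpose = (G y)⁻¹ := by rw [Matrix.transpose_nonsing_inv, h]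
  exact congrFun (congrFun this b) a

theorem sum_inv_mul_gram (hy : y ∈ Ω) (a b : Fin m) :
    ∑ c, (G y)⁻¹ a c * G y c b = if a = b then 1 else 0 := by
  have := Matrix.nonsing_inv_mul (G y) (hG.det_pos hy).ne'.isUnit
  rw [← Matrix.mul_apply, this, Matrix.one_apply]

theorem contDiffOn_coefficient (i j : Fin m) :
    ContDiffOn ℝ ∞ (fun z => √(G z).det * (G z)⁻¹ i j) Ω :=
  hG.contDiffOn_density.mul (hG.contDiffOn_inv i j)

theorem contDiffOn_coordLaplacian {f : Euc m → E} (hf : ContDiffOn ℝ ∞ f Ω) :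
    ContDiffOn ℝ ∞ (coordLaplacian G f) Ω := by
  refine (hG.contDiffOn_density.inv fun z hz => (hG.density_pos hz).ne').smul ?_
  exact ContDiffOn.sum fun i _ => (ContDiffOn.sum fun j _ =>
    (hG.contDiffOn_coefficient i j).smul (hf.pd hG.isOpen j)).pd hG.isOpen i

/-- The product rule turns the divergence form into a principal part plus a drift; the algebraic
identities below start from this form. -/
theorem coordLaplacian_eq {f : Euc m → E} (hf : ContDiffOn ℝ ∞ f Ω) (hy : y ∈ Ω) :
    coordLaplacian G f y
      = ∑ i, ∑ j, (G y)⁻¹ i j • pd i (pd j f) y + ∑ j, drift G j y • pd j f y := by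
  have h0 := (hG.density_pos hy).ne'
  have hc : ∀ i j, DifferentiableAt ℝ (fun z => √(G z).det * (G z)⁻¹ i j) y :=
    fun i j => (hG.contDiffOn_coefficient i j).diffAt hG.isOpen hy
  have hd : ∀ j, DifferentiableAt ℝ (pd j f) y := fun j => (hf.pd hG.isOpen j).diffAt hG.isOpen hy
  have h1 : ∀ i, pd i (fun z => ∑ j, (√(G z).det * (G z)⁻¹ i j) • pd j f z) y
      = ∑ j, ((√(G y).det * (G y)⁻¹ i j) • pd i (pd j f) y
        + pd i (fun z => √(G z).det * (G z)⁻¹ i j) y • pd j f y) := by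
    intro i
    refine (pd_sum _ i fun j _ => (hc i j).fun_smul (hd j)).trans ?_
    exact Finset.sum_congr rfl fun j _ => pd_smul i (hc i j) (hd j)
  simp only [coordLaplacian, h1, Finset.sum_add_distrib, smul_add, drift, Finset.smul_sum,
    smul_smul, ← mul_assoc, inv_mul_cancel₀ h0, one_mul, Finset.mul_sum, Finset.sum_smul]
  congr 1
  exact Finset.sum_comm

/-- The inner products `⟨∂_i ∂_k u, ∂_l u⟩` determine the derivatives of the metric. -/
theorem pd_gram (hy : y ∈ Ω) (i k l : Fin m) :
    pd i (fun z => G z k l) y = inner ℝ (pd i (pd k u) y) (pd l u y)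
      + inner ℝ (pd i (pd l u) y) (pd k u y) := by
  rw [pd_congr i (f := fun z => G z k l) (h := fun z => inner ℝ (pd k u z) (pd l u z))
    (Filter.eventuallyEq_of_mem (hG.isOpen.mem_nhds hy) fun z hz => hG.gram_eq z hz k l),
    pd_inner i ((hG.smooth.pd hG.isOpen k).diffAt hG.isOpen hy)
      ((hG.smooth.pd hG.isOpen l).diffAt hG.isOpen hy), add_comm, real_inner_comm (pd k u y)]

/-- Jacobi's formula gives half the trace of G⁻¹ ∂_i G. By `pd_gram` and the symmetry of G⁻¹ this
trace is twice a single sum, which absorbs the half. -/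
theorem pd_density (hy : y ∈ Ω) (i : Fin m) :
    pd i (fun z => √(G z).det) y
      = √(G y).det * ∑ k, ∑ l, (G y)⁻¹ k l * inner ℝ (pd i (pd k u) y) (pd l u y) := by
  have hpos := hG.det_pos hy
  have h1 : HasFDerivAt (fun z => (G z).det) (fderiv ℝ (fun z => (G z).det) y) y :=
    ((contDiffOn_det hG.contDiffOn_gram).diffAt hG.isOpen hy).hasFDerivAt
  have h2 := (h1.sqrt hpos.ne').fderiv
  have h3 : pd i (fun z => √(G z).det) y
      = (1 / (2 * √(G y).det)) * pd i (fun z => (G z).det) y := by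
    simp [pd, h2]
  have h4 : ∀ a b, (G y).adjugate b a = (G y).det * (G y)⁻¹ a b := by
    intro a b
    rw [hG.inv_symm hy, Matrix.inv_def]
    simp [hpos.ne']
  have h5 : ∑ a, ∑ b, (G y)⁻¹ a b * pd i (fun z => G z a b) y
      = 2 * ∑ k, ∑ l, (G y)⁻¹ k l * inner ℝ (pd i (pd k u) y) (pd l u y) := by
    simp only [hG.pd_gram hy, mul_add, Finset.sum_add_distrib, two_mul]
    congr 1
    rw [Finset.sum_comm]
    simp only [hG.inv_symm hy]
  rw [h3, pd_det i fun a b => (hG.contDiffOn_gram a b).diffAt hG.isOpen hy]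
  simp only [h4, mul_assoc, ← Finset.mul_sum]
  rw [h5]
  have h6 : (G y).det = √(G y).det * √(G y).det := (Real.mul_self_sqrt hpos.le).symm
  have h7 := (hG.density_pos hy).ne'
  generalize √(G y).det = r at *
  rw [h6]
  field_simp

/-- This is the formula -g^{ik} Γ^j_{ik}, with the Christoffel symbols expressed through second
derivatives of the immersion. -/
theorem drift_eq (hy : y ∈ Ω) (j : Fin m) :
    drift G j y = -∑ i, ∑ k, ∑ l,
      (G y)⁻¹ i k * inner ℝ (pd i (pd k u) y) (pd l u y) * (G y)⁻¹ l j := by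
  have h0 := (hG.density_pos hy).ne'
  have h1 : drift G j y = ∑ i, (pd i (fun z => (G z)⁻¹ i j) y
      + (∑ k, ∑ l, (G y)⁻¹ k l * inner ℝ (pd i (pd k u) y) (pd l u y)) * (G y)⁻¹ i j) := by
    rw [drift, Finset.mul_sum]
    refine Finset.sum_congr rfl fun i _ => ?_
    rw [pd_mul i (hG.contDiffOn_density.diffAt hG.isOpen hy)
      ((hG.contDiffOn_inv i j).diffAt hG.isOpen hy), hG.pd_density hy]
    field_simp
  -- The derivative of G⁻¹ splits in two by `pd_gram`. After commuting partial derivatives, one half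
  -- cancels the logarithmic derivative of the density.
  have h2 : ∑ i, ∑ k, ∑ l, (G y)⁻¹ i k * inner ℝ (pd i (pd l u) y) (pd k u y) * (G y)⁻¹ l j
      = ∑ i, (∑ k, ∑ l, (G y)⁻¹ k l * inner ℝ (pd i (pd k u) y) (pd l u y)) * (G y)⁻¹ i j := by
    calc _ = ∑ l, ∑ i, ∑ k,
          (G y)⁻¹ i k * inner ℝ (pd i (pd l u) y) (pd k u y) * (G y)⁻¹ l j := by
          rw [Finset.sum_comm]
          conv_lhs => enter [2, k]; rw [Finset.sum_comm]
          rw [Finset.sum_comm]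
          exact Finset.sum_congr rfl fun l _ => Finset.sum_comm
      _ = _ := by
          simp only [Finset.sum_mul]
          refine Finset.sum_congr rfl fun l _ => Finset.sum_congr rfl fun i _ =>
            Finset.sum_congr rfl fun k _ => ?_
          rw [pd_pd_comm hG.smooth hG.isOpen hy]
  rw [h1, Finset.sum_add_distrib, ← h2]
  simp only [pd_inv hG.isOpen hy _ hG.contDiffOn_gram (fun _ hz => (hG.det_pos hz).ne'),
    hG.pd_gram hy, mul_add, add_mul, Finset.sum_add_distrib, Finset.sum_neg_distrib, neg_add]
  ring

theorem sum_drift_mul_gram (hy : y ∈ Ω) (b : Fin m) :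
    ∑ j, drift G j y * G y j b
      = -∑ i, ∑ k, (G y)⁻¹ i k * inner ℝ (pd i (pd k u) y) (pd b u y) := by
  simp only [hG.drift_eq hy, neg_mul, Finset.sum_neg_distrib, Finset.sum_mul]
  congr 1
  rw [Finset.sum_comm]
  refine Finset.sum_congr rfl fun i _ => ?_
  rw [Finset.sum_comm]
  refine Finset.sum_congr rfl fun k _ => ?_
  rw [Finset.sum_comm]
  simp only [mul_assoc, ← Finset.mul_sum, hG.sum_inv_mul_gram hy]
  simp

/-- The Laplacian of an isometric immersion is normal. -/
theorem inner_coordLaplacian_pd (hy : y ∈ Ω) (b : Fin m) :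
    inner ℝ (coordLaplacian G u y) (pd b u y) = 0 := by
  have h := hG.sum_drift_mul_gram hy b
  rw [hG.coordLaplacian_eq hG.smooth hy, inner_add_left]
  simp only [sum_inner, real_inner_smul_left, ← hG.gram_eq y hy]
  rw [h, add_neg_cancel]

/-- A tangent vector that is orthogonal to all coordinate vectors has zero coefficients. -/
theorem coefficients_eq_zero (hy : y ∈ Ω) {w : Fin m → ℝ}
    (h : ∀ b, inner ℝ (∑ a, w a • pd a u y) (pd b u y) = 0) (a : Fin m) : w a = 0 := by
  have h1 : Matrix.vecMul w (G y) = 0 := by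
    funext b
    refine Eq.trans ?_ (h b)
    simp [Matrix.vecMul, dotProduct, sum_inner, real_inner_smul_left, hG.gram_eq y hy]
  have h2 : Matrix.vecMul (Matrix.vecMul w (G y)) (G y)⁻¹ = w := by
    rw [Matrix.vecMul_vecMul, Matrix.mul_nonsing_inv _ (hG.det_pos hy).ne'.isUnit,
      Matrix.vecMul_one]
  rw [← h2, h1, Matrix.zero_vecMul, Pi.zero_apply]

/-- A second order operator with the principal part of the Laplacian and without zeroth order
term is the Laplacian as soon as it maps the immersion to a normal field. -/
theorem coordLaplacian_unique (hy : y ∈ Ω) {β : Fin m → ℝ}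
    (hβ : ∀ b, inner ℝ (∑ i, ∑ j, (G y)⁻¹ i j • pd i (pd j u) y + ∑ a, β a • pd a u y)
      (pd b u y) = 0) {f : Euc m → E} (hf : ContDiffOn ℝ ∞ f Ω) :
    ∑ i, ∑ j, (G y)⁻¹ i j • pd i (pd j f) y + ∑ a, β a • pd a f y = coordLaplacian G f y := by
  -- Both operators have the same second order part and send u to normal vectors, so the difference
  -- of their values at u is tangent and normal at once.
  have h : ∀ a, β a - drift G a y = 0 := by
    refine hG.coefficients_eq_zero hy fun b => ?_
    have h1 := hG.inner_coordLaplacian_pd hy b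
    rw [hG.coordLaplacian_eq hG.smooth hy] at h1
    rw [← sub_eq_zero.2 ((hβ b).trans h1.symm), ← inner_sub_left]
    simp only [sub_smul, Finset.sum_sub_distrib]
    congr 1
    abel
  rw [hG.coordLaplacian_eq hf hy]
  simp only [sub_eq_zero.1 (h _)]

end IsInducedMetric

end CoordinateLaplacian

/-! ### Product rules, identities for spherical immersions, and coordinate independence. -/

section LaplacianIdentities

variable {m : ℕ} {E E' E'' F : Type*} [NormedAddCommGroup E] [NormedSpace ℝ E]
  [NormedAddCommGroup E'] [NormedSpace ℝ E'] [NormedAddCommGroup E''] [NormedSpace ℝ E'']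
  [NormedAddCommGroup F] [InnerProductSpace ℝ F] {Ω : Set (Euc m)} {y : Euc m}

theorem pd_bilinear (B : E →L[ℝ] E' →L[ℝ] E'') {f : Euc m → E} {h : Euc m → E'} (i : Fin m)
    (hf : DifferentiableAt ℝ f y) (hh : DifferentiableAt ℝ h y) :
    pd i (fun z => B (f z) (h z)) y = B (f y) (pd i h y) + B (pd i f y) (h y) := by
  have := (B.hasFDerivAt_of_bilinear hf.hasFDerivAt hh.hasFDerivAt).fderiv
  simp [pd, this]

theorem _root_.ContDiffOn.bilinear (B : E →L[ℝ] E' →L[ℝ] E'') {f : Euc m → E} {h : Euc m → E'}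
    (hf : ContDiffOn ℝ ∞ f Ω) (hh : ContDiffOn ℝ ∞ h Ω) :
    ContDiffOn ℝ ∞ (fun z => B (f z) (h z)) Ω :=
  (B.contDiff.comp_contDiffOn hf).clm_apply hh

/-- The inner product of the gradients of scalar functions, extended to vector valued functions
by a bilinear map `B`. -/
def gradProduct (G : Euc m → Matrix (Fin m) (Fin m) ℝ) (B : E →L[ℝ] E' →L[ℝ] E'')
    (f : Euc m → E) (h : Euc m → E') (y : Euc m) : E'' :=
  ∑ i, ∑ j, (G y)⁻¹ i j • B (pd i f y) (pd j h y)

/-- The real inner product as a bilinear map. -/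
def realInnerCLM : F →L[ℝ] F →L[ℝ] ℝ := innerSL ℝ

theorem realInnerCLM_apply (v w : F) : realInnerCLM v w = inner ℝ v w := rfl

theorem sphereProj_of_inner_eq_zero {v x : F} (h : inner ℝ v x = 0) : sphereProj v x = x :=
  Submodule.starProjection_eq_self_iff.2 (Submodule.mem_orthogonal_singleton_iff_inner_right.2 h)

namespace IsInducedMetric

variable {u : Euc m → F} {G : Euc m → Matrix (Fin m) (Fin m) ℝ}

theorem mono {Ω' : Set (Euc m)} (hG : IsInducedMetric Ω u G) (h : Ω' ⊆ Ω) (hΩ' : IsOpen Ω') :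
    IsInducedMetric Ω' u G :=
  ⟨hΩ', hG.smooth.mono h, fun y hy => hG.gram_eq y (h hy), fun y hy => hG.posDef y (h hy)⟩

variable (hG : IsInducedMetric Ω u G)

include hG

theorem contDiffOn_gradProduct (B : E →L[ℝ] E' →L[ℝ] E'') {f : Euc m → E} {h : Euc m → E'}
    (hf : ContDiffOn ℝ ∞ f Ω) (hh : ContDiffOn ℝ ∞ h Ω) :
    ContDiffOn ℝ ∞ (gradProduct G B f h) Ω :=
  ContDiffOn.sum fun i _ => ContDiffOn.sum fun j _ => (hG.contDiffOn_inv i j).smul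
    ((hf.pd hG.isOpen i).bilinear B (hh.pd hG.isOpen j))

/-- An arbitrary bilinear map covers inner products and scalar multiples together. The symmetry of
G⁻¹ merges the two cross terms into the factor 2. -/
theorem coordLaplacian_bilinear (B : E →L[ℝ] E' →L[ℝ] E'') {f : Euc m → E} {h : Euc m → E'}
    (hf : ContDiffOn ℝ ∞ f Ω) (hh : ContDiffOn ℝ ∞ h Ω) (hy : y ∈ Ω) :
    coordLaplacian G (fun z => B (f z) (h z)) y
      = B (coordLaplacian G f y) (h y) + (2 : ℝ) • gradProduct G B f h y
        + B (f y) (coordLaplacian G h y) := by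
  have h1 : ∀ j, Set.EqOn (pd j fun z => B (f z) (h z))
      (fun z => B (f z) (pd j h z) + B (pd j f z) (h z)) Ω := fun j z hz =>
    pd_bilinear B j (hf.diffAt hG.isOpen hz) (hh.diffAt hG.isOpen hz)
  have h2 : ∀ i j, pd i (pd j fun z => B (f z) (h z)) y
      = B (f y) (pd i (pd j h) y) + B (pd i (pd j f) y) (h y)
        + (B (pd i f y) (pd j h y) + B (pd j f y) (pd i h y)) := by
    intro i j
    have hf' := hf.pd hG.isOpen j
    have hh' := hh.pd hG.isOpen j
    rw [pd_congr_on hG.isOpen (h1 j) i hy,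
      pd_add i ((hf.bilinear B hh').diffAt hG.isOpen hy)
        ((hf'.bilinear B hh).diffAt hG.isOpen hy),
      pd_bilinear B i (hf.diffAt hG.isOpen hy) (hh'.diffAt hG.isOpen hy),
      pd_bilinear B i (hf'.diffAt hG.isOpen hy) (hh.diffAt hG.isOpen hy)]
    abel
  have h3 : ∑ i, ∑ j, (G y)⁻¹ i j • B (pd j f y) (pd i h y) = gradProduct G B f h y := by
    rw [Finset.sum_comm]
    refine Finset.sum_congr rfl fun i _ => Finset.sum_congr rfl fun j _ => ?_
    rw [hG.inv_symm hy]
  rw [hG.coordLaplacian_eq (hf.bilinear B hh) hy, hG.coordLaplacian_eq hf hy,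
    hG.coordLaplacian_eq hh hy]
  simp only [h2, smul_add, Finset.sum_add_distrib, h3]
  simp only [h1 _ hy, map_add, map_sum, map_smul,
    add_apply, sum_apply, smul_apply, smul_add,
    Finset.sum_add_distrib, two_smul]
  rw [gradProduct]
  abel

theorem coordLaplacian_inner {F' : Type*} [NormedAddCommGroup F'] [InnerProductSpace ℝ F']
    {f h : Euc m → F'}
    (hf : ContDiffOn ℝ ∞ f Ω) (hh : ContDiffOn ℝ ∞ h Ω) (hy : y ∈ Ω) :
    coordLaplacian G (fun z => inner ℝ (f z) (h z)) y
      = inner ℝ (coordLaplacian G f y) (h y) + 2 * gradProduct G realInnerCLM f h y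
        + inner ℝ (f y) (coordLaplacian G h y) :=
  hG.coordLaplacian_bilinear realInnerCLM hf hh hy

theorem coordLaplacian_smul {s : Euc m → ℝ} {f : Euc m → E}
    (hs : ContDiffOn ℝ ∞ s Ω) (hf : ContDiffOn ℝ ∞ f Ω) (hy : y ∈ Ω) :
    coordLaplacian G (fun z => s z • f z) y
      = coordLaplacian G s y • f y
        + (2 : ℝ) • gradProduct G (ContinuousLinearMap.lsmul ℝ ℝ) s f y
        + s y • coordLaplacian G f y :=
  hG.coordLaplacian_bilinear (ContinuousLinearMap.lsmul ℝ ℝ) hs hf hy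

theorem coordLaplacian_add {f h : Euc m → E}
    (hf : ContDiffOn ℝ ∞ f Ω) (hh : ContDiffOn ℝ ∞ h Ω) (hy : y ∈ Ω) :
    coordLaplacian G (fun z => f z + h z) y = coordLaplacian G f y + coordLaplacian G h y := by
  have h1 : ∀ j, Set.EqOn (pd j fun z => f z + h z) (fun z => pd j f z + pd j h z) Ω :=
    fun j z hz => pd_add j (hf.diffAt hG.isOpen hz) (hh.diffAt hG.isOpen hz)
  have h2 : ∀ i j, pd i (pd j fun z => f z + h z) y = pd i (pd j f) y + pd i (pd j h) y := by
    intro i j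
    rw [pd_congr_on hG.isOpen (h1 j) i hy, pd_add i ((hf.pd hG.isOpen j).diffAt hG.isOpen hy)
      ((hh.pd hG.isOpen j).diffAt hG.isOpen hy)]
  rw [hG.coordLaplacian_eq (hf.add hh) hy, hG.coordLaplacian_eq hf hy,
    hG.coordLaplacian_eq hh hy]
  simp only [h2, h1 _ hy, smul_add, Finset.sum_add_distrib]
  abel

theorem coordLaplacian_clm (A : E →L[ℝ] E') {f : Euc m → E} (hf : ContDiffOn ℝ ∞ f Ω)
    (hy : y ∈ Ω) : coordLaplacian G (fun z => A (f z)) y = A (coordLaplacian G f y) := by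
  have h1 : ∀ j, Set.EqOn (pd j fun z => A (f z)) (fun z => A (pd j f z)) Ω :=
    fun j z hz => pd_clm A j (hf.diffAt hG.isOpen hz)
  have h2 : ∀ i j, pd i (pd j fun z => A (f z)) y = A (pd i (pd j f) y) := by
    intro i j
    rw [pd_congr_on hG.isOpen (h1 j) i hy, pd_clm A i ((hf.pd hG.isOpen j).diffAt hG.isOpen hy)]
  rw [hG.coordLaplacian_eq (f := fun z => A (f z)) (A.contDiff.comp_contDiffOn hf) hy,
    hG.coordLaplacian_eq hf hy]
  simp [h2, h1 _ hy]

theorem coordLaplacian_congr {f h : Euc m → E} (H : Set.EqOn f h Ω) :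
    Set.EqOn (coordLaplacian G f) (coordLaplacian G h) Ω := by
  intro z hz
  simp only [coordLaplacian]
  congr 1
  refine Finset.sum_congr rfl fun i _ => pd_congr_on hG.isOpen (fun w hw => ?_) i hz
  refine Finset.sum_congr rfl fun j _ => ?_
  rw [pd_congr_on hG.isOpen H j hw]

theorem coordLaplacian_const {f : Euc m → E} {e : E} (hf : ∀ z ∈ Ω, f z = e) (hy : y ∈ Ω) :
    coordLaplacian G f y = 0 := by
  rw [hG.coordLaplacian_congr (h := fun _ => e) hf hy, coordLaplacian]
  have : ∀ (j : Fin m) (z : Euc m), pd j (fun _ : Euc m => e) z = 0 := fun j z => pd_const j e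
  simp [this, pd_const]

theorem gradProduct_self (hy : y ∈ Ω) : gradProduct G realInnerCLM u u y = m := by
  have : ∀ i, ∑ j, (G y)⁻¹ i j * inner ℝ (pd i u y) (pd j u y) = 1 := by
    intro i
    have := hG.sum_inv_mul_gram hy i i
    simp only [if_true] at this
    rw [← this]
    refine Finset.sum_congr rfl fun j _ => ?_
    rw [hG.gram_eq y hy, real_inner_comm]
  simp [gradProduct, realInnerCLM_apply, this]

/-- Differentiating ⟨Δu, ∂_j u⟩ = 0 moves a derivative from Δu onto ∂_j u. The trace is then -|Δu|²,
because the drift part of Δu is tangent and hence orthogonal to Δu. -/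
theorem gradProduct_coordLaplacian (hy : y ∈ Ω) :
    gradProduct G realInnerCLM (coordLaplacian G u) u y
      = -inner ℝ (coordLaplacian G u y) (coordLaplacian G u y) := by
  have hL := hG.contDiffOn_coordLaplacian hG.smooth
  have h1 : ∀ i j, inner ℝ (pd i (coordLaplacian G u) y) (pd j u y)
      = -inner ℝ (coordLaplacian G u y) (pd i (pd j u) y) := by
    intro i j
    have hj := hG.smooth.pd hG.isOpen j
    have h2 : pd i (fun z => inner ℝ (coordLaplacian G u z) (pd j u z)) y = 0 := by
      rw [pd_congr_on hG.isOpen (h := fun _ => (0 : ℝ))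
        (fun z hz => hG.inner_coordLaplacian_pd hz j) i hy, pd_const]
    rw [pd_inner i (hL.diffAt hG.isOpen hy) (hj.diffAt hG.isOpen hy)] at h2
    linarith
  conv_rhs => rw [hG.coordLaplacian_eq hG.smooth hy, inner_add_left]
  rw [← hG.coordLaplacian_eq hG.smooth hy]
  simp only [gradProduct, realInnerCLM_apply, h1, sum_inner, real_inner_smul_left, smul_eq_mul]
  have h3 : ∀ j, inner ℝ (pd j u y) (coordLaplacian G u y) = 0 := fun j => by
    rw [real_inner_comm, hG.inner_coordLaplacian_pd hy]
  simp [h3, real_inner_comm (coordLaplacian G u y)]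

/-- Apply Δ to the constant |u|²: 0 = 2⟨Δu, u⟩ + 2m, where m is the trace of G⁻¹G. -/
theorem inner_coordLaplacian_self {r : ℝ} (hu : ∀ z ∈ Ω, ‖u z‖ = r) (hy : y ∈ Ω) :
    inner ℝ (coordLaplacian G u y) (u y) = -m := by
  have h := hG.coordLaplacian_inner hG.smooth hG.smooth hy
  rw [hG.coordLaplacian_const (e := r * r)
    (fun z hz => by rw [real_inner_self_eq_norm_mul_norm, hu z hz]) hy, hG.gradProduct_self hy,
    real_inner_comm (coordLaplacian G u y) (u y)] at h
  linarith

/-- Apply Δ to the constant ⟨Δu, u⟩ = -m: 0 = ⟨Δ²u, u⟩ - 2|Δu|² + |Δu|². -/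
theorem inner_coordLaplacian_coordLaplacian {r : ℝ} (hu : ∀ z ∈ Ω, ‖u z‖ = r) (hy : y ∈ Ω) :
    inner ℝ (coordLaplacian G (coordLaplacian G u) y) (u y)
      = inner ℝ (coordLaplacian G u y) (coordLaplacian G u y) := by
  have h := hG.coordLaplacian_inner (hG.contDiffOn_coordLaplacian hG.smooth) hG.smooth hy
  rw [hG.coordLaplacian_const (fun z hz => hG.inner_coordLaplacian_self hu hz) hy,
    hG.gradProduct_coordLaplacian hy] at h
  linarith

open scoped MatrixOrder Matrix.Norms.L2Operator in
theorem exists_inv_eq_transpose_mul_self (hy : y ∈ Ω) :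
    ∃ B : Matrix (Fin m) (Fin m) ℝ, (G y)⁻¹ = B.transpose * B := by
  obtain ⟨B, hB⟩ :=
    CStarAlgebra.nonneg_iff_eq_star_mul_self.mp (hG.posDef y hy).inv.posSemidef.nonneg
  exact ⟨B, by rw [hB, Matrix.star_eq_conjTranspose, Matrix.conjTranspose_eq_transpose_of_trivial]⟩

/-- With G⁻¹ = BᵀB, the quantity |∇f|² is the sum over k of |∑_i B_ki ∂_i f|². All these vectors
vanish, and applying Bᵀ and then G recovers ∂_i f. -/
theorem pd_eq_zero_of_gradProduct {f : Euc m → F} (hy : y ∈ Ω)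
    (h : gradProduct G realInnerCLM f f y = 0) (i : Fin m) : pd i f y = 0 := by
  obtain ⟨B, hB⟩ := hG.exists_inv_eq_transpose_mul_self hy
  have h1 : gradProduct G realInnerCLM f f y
      = ∑ k, inner ℝ (∑ i, B k i • pd i f y) (∑ i, B k i • pd i f y) := by
    simp only [gradProduct, hB, Matrix.mul_apply, Matrix.transpose_apply, realInnerCLM_apply,
      smul_eq_mul, sum_inner, inner_sum, real_inner_smul_left, real_inner_smul_right,
      Finset.sum_mul]
    rw [Finset.sum_comm' (t' := Finset.univ) (s' := fun _ => Finset.univ) (by simp)]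
    conv_lhs => enter [2, j]; rw [Finset.sum_comm]
    rw [Finset.sum_comm]
    exact Finset.sum_congr rfl fun k _ => Finset.sum_congr rfl fun i _ =>
      Finset.sum_congr rfl fun j _ => by rw [real_inner_comm (pd i f y) (pd j f y)]; ring
  have h2 : ∀ k, ∑ i, B k i • pd i f y = 0 := by
    rw [h1, Finset.sum_eq_zero_iff_of_nonneg fun _ _ => real_inner_self_nonneg] at h
    exact fun k => inner_self_eq_zero.1 (h k (Finset.mem_univ k))
  have h3 : ∀ k, ∑ i, (G y)⁻¹ k i • pd i f y = 0 := by
    intro k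
    simp only [hB, Matrix.mul_apply, Matrix.transpose_apply, Finset.sum_smul]
    rw [Finset.sum_comm]
    refine Finset.sum_eq_zero fun l _ => ?_
    simp only [mul_smul, ← Finset.smul_sum, h2, smul_zero]
  have h4 : ∑ k, G y i k • ∑ j, (G y)⁻¹ k j • pd j f y = pd i f y := by
    simp only [Finset.smul_sum, smul_smul]
    rw [Finset.sum_comm]
    simp only [← Finset.sum_smul, ← Matrix.mul_apply,
      Matrix.mul_nonsing_inv _ (hG.det_pos hy).ne'.isUnit, Matrix.one_apply]
    simp
  rw [← h4]
  simp [h3]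

/-- Expanding the three derivatives of the metric gives six products; symmetry of second derivatives
cancels four and doubles the remaining one. -/
theorem christoffel_eq (hy : y ∈ Ω) (k i j : Fin m) :
    (1 / 2) * ∑ l, (G y)⁻¹ k l *
      (pd i (fun z => G z j l) y + pd j (fun z => G z i l) y - pd l (fun z => G z i j) y)
      = ∑ l, (G y)⁻¹ k l * inner ℝ (pd i (pd j u) y) (pd l u y) := by
  rw [Finset.mul_sum]
  refine Finset.sum_congr rfl fun l _ => ?_
  have hc := fun a b => pd_pd_comm hG.smooth hG.isOpen hy a b
  rw [hG.pd_gram hy, hG.pd_gram hy, hG.pd_gram hy, hc l i, hc l j, hc j i]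
  ring

/-- The map v need not be the immersion u that induces the metric: it will be a member of a
variation. As P fixes each ∂_k v, it passes through the first order terms, and the trace of Γ is
minus the drift. -/
theorem tension_eq (hy : y ∈ Ω) {v : Euc m → E} (hv : ContDiffOn ℝ ∞ v Ω) (P : E →L[ℝ] E)
    (hP : ∀ k, P (pd k v y) = pd k v y) (Γ : Fin m → Fin m → Fin m → ℝ)
    (hΓ : ∀ k i j, Γ k i j = ∑ l, (G y)⁻¹ k l * inner ℝ (pd i (pd j u) y) (pd l u y)) :
    ∑ i, ∑ j, (G y)⁻¹ i j • (P (pd i (pd j v) y) - ∑ k, Γ k i j • pd k v y)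
      = P (coordLaplacian G v y) := by
  have h1 : ∑ i, ∑ j, (G y)⁻¹ i j • ∑ k, Γ k i j • pd k v y = -∑ k, drift G k y • pd k v y := by
    rw [← Finset.sum_neg_distrib]
    have : ∀ i, ∑ j, (G y)⁻¹ i j • ∑ k, Γ k i j • pd k v y
        = ∑ k, (∑ j, (G y)⁻¹ i j * Γ k i j) • pd k v y := by
      intro i
      simp only [Finset.smul_sum, smul_smul, Finset.sum_smul]
      exact Finset.sum_comm
    simp only [this]
    rw [Finset.sum_comm]
    refine Finset.sum_congr rfl fun k _ => ?_
    rw [← Finset.sum_smul, ← neg_smul, hG.drift_eq hy, neg_neg]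
    congr 1
    refine Finset.sum_congr rfl fun i _ => Finset.sum_congr rfl fun j _ => ?_
    rw [hΓ, Finset.mul_sum]
    refine Finset.sum_congr rfl fun l _ => ?_
    rw [hG.inv_symm hy k l]
    ring
  simp only [smul_sub, Finset.sum_sub_distrib]
  rw [h1, hG.coordLaplacian_eq hv hy]
  simp [hP]

/-- Change of coordinates: the entries of the Jacobian matrix and the two metrics. -/
theorem gram_comp {Ω' : Set (Euc m)} {T : Euc m → Euc m}
    {u' : Euc m → F} {G' : Euc m → Matrix (Fin m) (Fin m) ℝ} (hG' : IsInducedMetric Ω' u' G')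
    (hT : ContDiffOn ℝ ∞ T Ω') (hTm : Set.MapsTo T Ω' Ω) (hu : ∀ z ∈ Ω', u' z = u (T z))
    (hy : y ∈ Ω') {J : Matrix (Fin m) (Fin m) ℝ} (hJ : ∀ a i, J a i = pd i T y a) :
    G' y = J.transpose * G (T y) * J := by
  have h : ∀ i, pd i u' y = ∑ a, J a i • pd a u (T y) := by
    intro i
    rw [pd_congr_on hG'.isOpen (h := fun z => u (T z)) hu i hy,
      pd_comp i (hG.smooth.diffAt hG.isOpen (hTm hy)) (hT.diffAt hG'.isOpen hy)]
    simp only [hJ]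
  ext i j
  rw [hG'.gram_eq y hy, h, h]
  simp only [Matrix.mul_apply, Matrix.transpose_apply, sum_inner, inner_sum,
    real_inner_smul_left, real_inner_smul_right, hG.gram_eq _ (hTm hy), Finset.sum_mul]
  exact Finset.sum_congr rfl fun a _ => Finset.sum_congr rfl fun b _ => by
    rw [real_inner_comm (pd a u (T y)) (pd b u (T y))]; ring

end IsInducedMetric

/-- The first order coefficients of the Laplacian after a change of coordinates `T`. -/
def transitionDrift (G' : Euc m → Matrix (Fin m) (Fin m) ℝ) (T : Euc m → Euc m) (y : Euc m)
    (a : Fin m) : ℝ :=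
  ∑ i, ∑ j, (G' y)⁻¹ i j * pd i (fun z => pd j T z a) y + ∑ j, drift G' j y * pd j T y a

/-- The Laplacian of a composition. -/
theorem coordLaplacian_comp_eq {Ω' : Set (Euc m)} {T : Euc m → Euc m}
    {u' : Euc m → F} {G' : Euc m → Matrix (Fin m) (Fin m) ℝ} (hG' : IsInducedMetric Ω' u' G')
    (hΩ : IsOpen Ω) (hT : ContDiffOn ℝ ∞ T Ω') (hTm : Set.MapsTo T Ω' Ω)
    {N J : Matrix (Fin m) (Fin m) ℝ} (hy : y ∈ Ω') (hJ : ∀ a i, J a i = pd i T y a)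
    (hinv : J * (G' y)⁻¹ * J.transpose = N)
    {f f' : Euc m → E} (hf : ContDiffOn ℝ ∞ f Ω) (hff' : ∀ z ∈ Ω', f' z = f (T z)) :
    (∀ j, pd j f' y = ∑ a, J a j • pd a f (T y)) ∧ coordLaplacian G' f' y
      = ∑ a, ∑ b, N a b • pd a (pd b f) (T y)
        + ∑ a, transitionDrift G' T y a • pd a f (T y) := by
  have hent : ∀ j a, ContDiffOn ℝ ∞ (fun z => pd j T z a) Ω' := fun j a =>
    contDiffOn_entry (hT.pd hG'.isOpen j) a
  have hd : ∀ b, ContDiffOn ℝ ∞ (pd b f) Ω := fun b => hf.pd hΩ b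
  have hdT : ∀ b, ContDiffOn ℝ ∞ (fun z => pd b f (T z)) Ω' := fun b => (hd b).comp hT hTm
  have hf' : ContDiffOn ℝ ∞ f' Ω' := (hf.comp hT hTm).congr hff'
  have h1 : ∀ j, Set.EqOn (pd j f') (fun z => ∑ b, pd j T z b • pd b f (T z)) Ω' := by
    intro j z hz
    rw [pd_congr_on hG'.isOpen (h := fun z => f (T z)) hff' j hz]
    exact pd_comp j (hf.diffAt hΩ (hTm hz)) (hT.diffAt hG'.isOpen hz)
  have h2 : ∀ i j, pd i (pd j f') y = ∑ b, ∑ a, (J a i * J b j) • pd a (pd b f) (T y)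
      + ∑ b, pd i (fun z => pd j T z b) y • pd b f (T y) := by
    intro i j
    rw [pd_congr_on hG'.isOpen (h1 j) i hy, ← Finset.sum_add_distrib]
    refine (pd_sum _ i fun b _ => (((hent j b).smul (hdT b)).diffAt hG'.isOpen hy)).trans ?_
    refine Finset.sum_congr rfl fun b _ => ?_
    refine (pd_smul i ((hent j b).diffAt hG'.isOpen hy)
      ((hdT b).diffAt hG'.isOpen hy)).trans ?_
    rw [pd_comp i ((hd b).diffAt hΩ (hTm hy)) (hT.diffAt hG'.isOpen hy), Finset.smul_sum]
    simp only [smul_smul, hJ, mul_comm]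
  refine ⟨fun j => by simp only [hJ]; exact h1 j hy, ?_⟩
  rw [hG'.coordLaplacian_eq hf' hy]
  simp only [h2, smul_add, Finset.sum_add_distrib]
  have e1 : ∑ i, ∑ j, (G' y)⁻¹ i j • ∑ b, ∑ a, (J a i * J b j) • pd a (pd b f) (T y)
      = ∑ a, ∑ b, N a b • pd a (pd b f) (T y) := by
    have e0 : ∀ a b, N a b = ∑ i, ∑ j, (G' y)⁻¹ i j * (J a i * J b j) := by
      intro a b
      rw [← hinv]
      simp only [Matrix.mul_apply, Matrix.transpose_apply, Finset.sum_mul]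
      rw [Finset.sum_comm]
      exact Finset.sum_congr rfl fun _ _ => Finset.sum_congr rfl fun _ _ => by ring
    simp only [e0, Finset.sum_smul, Finset.smul_sum, smul_smul]
    calc _ = ∑ i, ∑ j, ∑ a, ∑ b,
          ((G' y)⁻¹ i j * (J a i * J b j)) • pd a (pd b f) (T y) :=
          Finset.sum_congr rfl fun i _ => Finset.sum_congr rfl fun j _ => Finset.sum_comm
      _ = ∑ i, ∑ a, ∑ j, ∑ b,
          ((G' y)⁻¹ i j * (J a i * J b j)) • pd a (pd b f) (T y) :=
          Finset.sum_congr rfl fun i _ => Finset.sum_comm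
      _ = ∑ a, ∑ i, ∑ j, ∑ b,
          ((G' y)⁻¹ i j * (J a i * J b j)) • pd a (pd b f) (T y) := Finset.sum_comm
      _ = ∑ a, ∑ i, ∑ b, ∑ j,
          ((G' y)⁻¹ i j * (J a i * J b j)) • pd a (pd b f) (T y) :=
          Finset.sum_congr rfl fun i _ => Finset.sum_congr rfl fun j _ => Finset.sum_comm
      _ = _ := Finset.sum_congr rfl fun a _ => Finset.sum_comm
  have e2 : ∑ i, ∑ j, (G' y)⁻¹ i j • ∑ b, pd i (fun z => pd j T z b) y • pd b f (T y)
      + ∑ j, drift G' j y • pd j f' y = ∑ a, transitionDrift G' T y a • pd a f (T y) := by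
    simp only [transitionDrift, add_smul, Finset.sum_add_distrib, Finset.sum_smul, h1 _ hy,
      Finset.smul_sum, smul_smul]
    congr 1
    · calc _ = ∑ i, ∑ b, ∑ j,
            ((G' y)⁻¹ i j * pd i (fun z => pd j T z b) y) • pd b f (T y) :=
            Finset.sum_congr rfl fun i _ => Finset.sum_comm
        _ = _ := Finset.sum_comm
    · exact Finset.sum_comm
  rw [add_assoc, e1, e2]

namespace IsInducedMetric

variable {u : Euc m → F} {G : Euc m → Matrix (Fin m) (Fin m) ℝ}

/-- From det G' = (det J)² det G with det G' positive; no inverse of the transition map is needed.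
-/
theorem isUnit_det_jacobian (hG : IsInducedMetric Ω u G) {Ω' : Set (Euc m)} {T : Euc m → Euc m}
    {u' : Euc m → F} {G' : Euc m → Matrix (Fin m) (Fin m) ℝ} (hG' : IsInducedMetric Ω' u' G')
    (hT : ContDiffOn ℝ ∞ T Ω') (hTm : Set.MapsTo T Ω' Ω) (hu : ∀ z ∈ Ω', u' z = u (T z))
    (hy : y ∈ Ω') {J : Matrix (Fin m) (Fin m) ℝ} (hJ : ∀ a i, J a i = pd i T y a) :
    IsUnit J.det := by
  have := hG'.det_pos hy
  rw [hG.gram_comp hG' hT hTm hu hy hJ, Matrix.det_mul] at this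
  exact (right_ne_zero_of_mul this.ne').isUnit

/-- The Laplacian does not depend on the coordinates. -/
theorem coordLaplacian_comp (hG : IsInducedMetric Ω u G) {Ω' : Set (Euc m)} {T : Euc m → Euc m}
    {u' : Euc m → F} {G' : Euc m → Matrix (Fin m) (Fin m) ℝ} (hG' : IsInducedMetric Ω' u' G')
    (hT : ContDiffOn ℝ ∞ T Ω') (hTm : Set.MapsTo T Ω' Ω) (hu : ∀ z ∈ Ω', u' z = u (T z))
    {f f' : Euc m → E} (hf : ContDiffOn ℝ ∞ f Ω) (hff' : ∀ z ∈ Ω', f' z = f (T z))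
    (hy : y ∈ Ω') : coordLaplacian G' f' y = coordLaplacian G f (T y) := by
  obtain ⟨J, hJ⟩ : ∃ J : Matrix (Fin m) (Fin m) ℝ, ∀ a i, J a i = pd i T y a :=
    ⟨Matrix.of fun a i => pd i T y a, fun _ _ => rfl⟩
  have hJdet := hG.isUnit_det_jacobian hG' hT hTm hu hy hJ
  have hinv : J * (G' y)⁻¹ * J.transpose = (G (T y))⁻¹ := by
    have hJt : IsUnit J.transpose.det := by rwa [Matrix.det_transpose]
    rw [hG.gram_comp hG' hT hTm hu hy hJ, Matrix.mul_inv_rev, Matrix.mul_inv_rev,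
      Matrix.mul_nonsing_inv_cancel_left _ _ hJdet,
      Matrix.nonsing_inv_mul_cancel_right _ _ hJt]
  rw [(coordLaplacian_comp_eq hG' hG.isOpen hT hTm hy hJ hinv hf hff').2]
  -- The drift need not be transformed by hand. It suffices that the transported operator sends u to
  -- a normal vector. That vector is the Laplacian of u', which is orthogonal to each ∂_i u' and so,
  -- J being invertible, to each ∂_b u.
  refine hG.coordLaplacian_unique (hTm hy) (fun b => ?_) hf
  have hc := coordLaplacian_comp_eq hG' hG.isOpen hT hTm hy hJ hinv hG.smooth hu
  rw [← hc.2]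
  have h3 : Matrix.vecMul (fun b => inner ℝ (coordLaplacian G' u' y) (pd b u (T y))) J = 0 := by
    funext i
    refine Eq.trans ?_ (hG'.inner_coordLaplacian_pd hy i)
    rw [hc.1 i]
    simp [Matrix.vecMul, dotProduct, inner_sum, real_inner_smul_right, mul_comm]
  have h4 := congrArg (fun w => Matrix.vecMul w J⁻¹) h3
  simp only [Matrix.vecMul_vecMul, Matrix.mul_nonsing_inv _ hJdet, Matrix.vecMul_one,
    Matrix.zero_vecMul] at h4
  exact congrFun h4 b

end IsInducedMetric

end LaplacianIdentities

/-! ### Passage from the manifold to its charts. -/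

section Charts

variable {m : ℕ} {M : Type*} [TopologicalSpace M] [ChartedSpace (Euc m) M]
  [IsManifold (𝓡 m) ∞ M] {E F : Type*} [NormedAddCommGroup E] [NormedSpace ℝ E]
  [NormedAddCommGroup F] [InnerProductSpace ℝ F]
  {c : OpenPartialHomeomorph M (Euc m)} {y : Euc m}

theorem contMDiffOn_symm_of_mem_atlas (hc : c ∈ atlas (Euc m) M) :
    ContMDiffOn (𝓡 m) (𝓡 m) ∞ c.symm c.target :=
  contMDiffOn_symm_of_mem_maximalAtlas (IsManifold.subset_maximalAtlas hc)

theorem contMDiffOn_of_mem_atlas (hc : c ∈ atlas (Euc m) M) :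
    ContMDiffOn (𝓡 m) (𝓡 m) ∞ c c.source :=
  contMDiffOn_of_mem_maximalAtlas (IsManifold.subset_maximalAtlas hc)

theorem _root_.ContMDiff.comp_chart_symm {f : M → E} (hf : ContMDiff (𝓡 m) 𝓘(ℝ, E) ∞ f)
    (hc : c ∈ atlas (Euc m) M) : ContDiffOn ℝ ∞ (fun w => f (c.symm w)) c.target :=
  (hf.comp_contMDiffOn (contMDiffOn_symm_of_mem_atlas hc)).contDiffOn

theorem contDiffOn_transition {c' : OpenPartialHomeomorph M (Euc m)} (hc : c ∈ atlas (Euc m) M)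
    (hc' : c' ∈ atlas (Euc m) M) :
    ContDiffOn ℝ ∞ (fun z => c (c'.symm z)) (c'.symm.trans c).source := by
  refine ((contMDiffOn_of_mem_atlas hc).comp
    ((contMDiffOn_symm_of_mem_atlas hc').mono ?_) ?_).contDiffOn
  · intro z hz; simp at hz; exact hz.1
  · intro z hz; simp at hz; exact hz.2

theorem mfderiv_symm_ne_zero (hc : c ∈ atlas (Euc m) M) (hy : y ∈ c.target) {x : Euc m}
    (hx : x ≠ 0) : mfderiv (𝓡 m) (𝓡 m) c.symm y x ≠ 0 := by
  have h : c.MDifferentiable (𝓡 m) (𝓡 m) := mdifferentiable_of_mem_atlas hc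
  exact fun h0 => hx (h.symm.mfderiv_injective hy (h0.trans (map_zero _).symm))

theorem pd_comp_symm {f : M → E} (hf : ContMDiff (𝓡 m) 𝓘(ℝ, E) ∞ f) (hc : c ∈ atlas (Euc m) M)
    (hy : y ∈ c.target) (i : Fin m) : pd i (fun w => f (c.symm w)) y
      = mfderiv (𝓡 m) 𝓘(ℝ, E) f (c.symm y) (coordVec c y i) := by
  have h1 : MDifferentiableAt (𝓡 m) (𝓡 m) c.symm y :=
    ((contMDiffOn_symm_of_mem_atlas hc).contMDiffAt (c.open_target.mem_nhds hy)).mdifferentiableAt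
      (by simp)
  have h2 : MDifferentiableAt (𝓡 m) 𝓘(ℝ, E) f (c.symm y) :=
    hf.contMDiffAt.mdifferentiableAt (by simp)
  have h3 := mfderiv_comp y h2 h1
  rw [mfderiv_eq_fderiv] at h3
  change fderiv ℝ (f ∘ c.symm) y _ = _
  rw [h3]
  rfl

/-- The bridge to coordinates. Positive definiteness comes from that of g and the injectivity of the
derivative of the inverse chart. -/
theorem isInducedMetric_gram {g : Metric m M} {φ : M → F} (hφ : IsIsometricImmersion g φ)
    (hc : c ∈ atlas (Euc m) M) :
    IsInducedMetric c.target (fun w => φ (c.symm w)) (gram g c) where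
  isOpen := c.open_target
  smooth := hφ.1.comp_chart_symm hc
  gram_eq y hy i j := by
    rw [pd_comp_symm hφ.1 hc hy, pd_comp_symm hφ.1 hc hy]
    exact (hφ.2 _ _ _).symm
  posDef y hy := by
    refine Matrix.PosDef.of_dotProduct_mulVec_pos ?_ ?_
    · ext i j
      simp [gram, g.symm (c.symm y) (coordVec c y i)]
    · intro x hx
      have hV : mfderiv (𝓡 m) (𝓡 m) c.symm y (WithLp.toLp 2 x : Euc m)
          = ∑ i, x i • coordVec c y i := by
        have : (WithLp.toLp 2 x : Euc m)
            = ∑ i, x i • (EuclideanSpace.single i (1 : ℝ) : Euc m) := by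
          ext k; simp [Pi.single_apply]
        simp only [coordVec]
        conv_lhs => rw [this]
        exact (map_sum _ _ _).trans (Finset.sum_congr rfl fun i _ => map_smul _ _ _)
      have h0 := g.pos (c.symm y) _ (mfderiv_symm_ne_zero hc hy (x := WithLp.toLp 2 x)
        (by simpa using hx))
      rw [hV] at h0
      refine h0.trans_eq ?_
      simp only [map_sum, map_smul, sum_apply, smul_apply, gram, dotProduct, Matrix.mulVec,
        Matrix.of_apply, smul_eq_mul, Pi.star_apply, star_trivial, Finset.mul_sum]
      rw [Finset.sum_comm]
      exact Finset.sum_congr rfl fun i _ => Finset.sum_congr rfl fun j _ => by ring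

/-- `laplacian` uses the preferred chart of each point, which changes with the point.
Differentiating or iterating it requires one fixed chart. -/
theorem laplacian_eq_of_mem_atlas {g : Metric m M} {φ : M → F} (hφ : IsIsometricImmersion g φ)
    (hc : c ∈ atlas (Euc m) M) {f : M → E} (hf : ContMDiff (𝓡 m) 𝓘(ℝ, E) ∞ f) {q : M}
    (hq : q ∈ c.source) :
    laplacian g f q = coordLaplacian (gram g c) (fun w => f (c.symm w)) (c q) := by
  set c' := chartAt (Euc m) q with hc'_def
  have hc' : c' ∈ atlas (Euc m) M := chart_mem_atlas _ q
  have hq' : q ∈ c'.source := mem_chart_source _ q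
  have hsub : (c'.symm.trans c).source ⊆ c'.target := fun z hz => by simp at hz; exact hz.1
  have hG := isInducedMetric_gram hφ hc
  have hG' := (isInducedMetric_gram hφ hc').mono hsub (c'.symm.trans c).open_source
  have hmem : ∀ z ∈ (c'.symm.trans c).source, c'.symm z ∈ c.source :=
    fun z hz => by simp at hz; exact hz.2
  have hy : c' q ∈ (c'.symm.trans c).source := by simp [hq', hq]
  have := hG.coordLaplacian_comp hG' (contDiffOn_transition hc hc')
    (fun z hz => c.map_source (hmem z hz)) (f' := fun w => f (c'.symm w))
    (fun z hz => by simp [c.left_inv (hmem z hz)]) (hf.comp_chart_symm hc)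
    (fun z hz => by simp [c.left_inv (hmem z hz)]) hy
  rw [c'.left_inv hq'] at this
  exact this

theorem laplacian_comp_symm {g : Metric m M} {φ : M → F} (hφ : IsIsometricImmersion g φ)
    (hc : c ∈ atlas (Euc m) M) {f : M → E} (hf : ContMDiff (𝓡 m) 𝓘(ℝ, E) ∞ f) :
    Set.EqOn (fun w => laplacian g f (c.symm w))
      (coordLaplacian (gram g c) (fun w => f (c.symm w))) c.target := by
  intro z hz
  simp only [laplacian_eq_of_mem_atlas hφ hc hf (c.map_target hz), c.right_inv hz]

theorem contMDiff_of_comp_chart_symm {f : M → E}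
    (h : ∀ c ∈ atlas (Euc m) M, ContDiffOn ℝ ∞ (fun w => f (c.symm w)) c.target) :
    ContMDiff (𝓡 m) 𝓘(ℝ, E) ∞ f := by
  intro p
  set c := chartAt (Euc m) p
  have hc : c ∈ atlas (Euc m) M := chart_mem_atlas _ p
  have h1 : ContMDiffOn (𝓡 m) 𝓘(ℝ, E) ∞ ((fun w => f (c.symm w)) ∘ c) c.source :=
    (h c hc).contMDiffOn.comp (contMDiffOn_of_mem_atlas hc) fun z hz => c.map_source hz
  refine (h1.congr fun z hz => ?_).contMDiffAt (c.open_source.mem_nhds (mem_chart_source _ p))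
  simp [c.left_inv hz]

theorem contMDiff_laplacian {g : Metric m M} {φ : M → F} (hφ : IsIsometricImmersion g φ)
    {f : M → E} (hf : ContMDiff (𝓡 m) 𝓘(ℝ, E) ∞ f) :
    ContMDiff (𝓡 m) 𝓘(ℝ, E) ∞ (laplacian g f) :=
  contMDiff_of_comp_chart_symm fun _ hc => ((isInducedMetric_gram hφ hc).contDiffOn_coordLaplacian
    (hf.comp_chart_symm hc)).congr (laplacian_comp_symm hφ hc hf)

/-- The tension field of a map into a sphere is the tangential part of its Laplacian. -/
theorem tension_eq_sphereProj {g : Metric m M} {φ : M → F} (hφ : IsIsometricImmersion g φ)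
    {F' : Type*} [NormedAddCommGroup F'] [InnerProductSpace ℝ F']
    {v : M → F'} (hv : ContMDiff (𝓡 m) 𝓘(ℝ, F') ∞ v) {r : ℝ} (hr : ∀ p, ‖v p‖ = r) (p : M) :
    tension g v p = sphereProj (v p) (laplacian g v p) := by
  set c := chartAt (Euc m) p with hc_def
  have hc : c ∈ atlas (Euc m) M := chart_mem_atlas _ p
  have hp : p ∈ c.source := mem_chart_source _ p
  have hy := c.map_source hp
  have hG := isInducedMetric_gram hφ hc
  have hv' := hv.comp_chart_symm hc
  -- Since |v| is constant, every ∂_k v is orthogonal to v and hence fixed by the projection.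
  have hP : ∀ k, inner ℝ (v (c.symm (c p))) (pd k (fun w => v (c.symm w)) (c p)) = 0 := by
    intro k
    have hd := hv'.diffAt c.open_target hy
    have h1 := pd_inner k hd hd
    rw [pd_congr k (h := fun _ => r * r) (Filter.Eventually.of_forall fun z => by
      rw [real_inner_self_eq_norm_mul_norm, hr]), pd_const, real_inner_comm] at h1
    rw [real_inner_comm]
    linarith
  have := hG.tension_eq hy hv' (sphereProj (v (c.symm (c p))))
    (fun k => sphereProj_of_inner_eq_zero (hP k))
    (fun k i j => christoffel g c k i j (c p)) (fun k i j => hG.christoffel_eq hy k i j)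
  rw [laplacian_eq_of_mem_atlas hφ hc hv hp]
  rw [c.left_inv hp] at this
  refine Eq.trans ?_ this
  simp only [tension, secondFundamentalForm, ← hc_def, c.left_inv hp]

end Charts

/-! ### The Riemannian volume in a chart. -/

section Volume

variable {m : ℕ} {F : Type*} [NormedAddCommGroup F] [InnerProductSpace ℝ F] {y : Euc m}

theorem det_fderiv_eq {T : Euc m → Euc m} {J : Matrix (Fin m) (Fin m) ℝ}
    (hJ : ∀ a i, J a i = pd i T y a) : (fderiv ℝ T y).det = J.det := by
  have : J = LinearMap.toMatrix (EuclideanSpace.basisFun (Fin m) ℝ).toBasis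
      (EuclideanSpace.basisFun (Fin m) ℝ).toBasis (fderiv ℝ T y : Euc m →ₗ[ℝ] Euc m) := by
    ext a i
    rw [hJ, LinearMap.toMatrix_apply]
    simp [pd]
  rw [this, LinearMap.det_toMatrix]

theorem IsInducedMetric.density_comp {Ω Ω' : Set (Euc m)} {u u' : Euc m → F}
    {G G' : Euc m → Matrix (Fin m) (Fin m) ℝ} (hG : IsInducedMetric Ω u G) {T : Euc m → Euc m}
    (hG' : IsInducedMetric Ω' u' G')
    (hT : ContDiffOn ℝ ∞ T Ω') (hTm : Set.MapsTo T Ω' Ω) (hu : ∀ z ∈ Ω', u' z = u (T z))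
    (hy : y ∈ Ω') : √(G' y).det = |(fderiv ℝ T y).det| * √(G (T y)).det := by
  obtain ⟨J, hJ⟩ : ∃ J : Matrix (Fin m) (Fin m) ℝ, ∀ a i, J a i = pd i T y a :=
    ⟨Matrix.of fun a i => pd i T y a, fun _ _ => rfl⟩
  rw [hG.gram_comp hG' hT hTm hu hy hJ, det_fderiv_eq hJ, Matrix.det_mul, Matrix.det_mul,
    Matrix.det_transpose, show J.det * (G (T y)).det * J.det = J.det ^ 2 * (G (T y)).det by ring,
    Real.sqrt_mul (sq_nonneg _), Real.sqrt_sq_eq_abs]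

variable {M : Type*} [TopologicalSpace M] [MeasurableSpace M] [BorelSpace M]

theorem measurableSet_target_inter_preimage (c : OpenPartialHomeomorph M (Euc m)) {A : Set M}
    (hA : MeasurableSet A) : MeasurableSet (c.target ∩ c.symm ⁻¹' A) := by
  classical
  rcases c.target.eq_empty_or_nonempty with h | ⟨z, -⟩
  · simp [h]
  -- Outside the target nothing is known about `c.symm`, so it is replaced there by a constant.
  have h1 : Measurable (c.target.piecewise c.symm fun _ => c.symm z) :=
    ContinuousOn.measurable_piecewise c.continuousOn_symm continuousOn_const
      c.open_target.measurableSet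
  have h2 : c.target ∩ c.symm ⁻¹' A
      = c.target ∩ (c.target.piecewise c.symm fun _ => c.symm z) ⁻¹' A := by
    ext w
    simp only [Set.mem_inter_iff, Set.mem_preimage]
    refine and_congr_right fun hw => ?_
    rw [Set.piecewise_eq_of_mem _ _ _ hw]
  rw [h2]
  exact c.open_target.measurableSet.inter (h1 hA)

theorem aemeasurable_chart_symm (c : OpenPartialHomeomorph M (Euc m)) :
    AEMeasurable c.symm ((volume : Measure (Euc m)).restrict c.target) :=
  c.continuousOn_symm.aemeasurable c.open_target.measurableSet

variable [ChartedSpace (Euc m) M] [IsManifold (𝓡 m) ∞ M] {g : Metric m M} {φ : M → F}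

theorem chartVolume_apply (g : Metric m M) (p : M) {A : Set M} (hA : MeasurableSet A) :
    chartVolume g p A = ∫⁻ y in (chartAt (Euc m) p).target ∩ (chartAt (Euc m) p).symm ⁻¹' A,
      ENNReal.ofReal (volDensity g (chartAt (Euc m) p) y) := by
  simp only [chartVolume]
  rw [Measure.map_apply_of_aemeasurable ((aemeasurable_chart_symm _).mono_ac
    (withDensity_absolutelyContinuous _ _)) hA, withDensity_apply',
    Measure.restrict_restrict' (chartAt (Euc m) p).open_target.measurableSet, Set.inter_comm]

/-- The change of variables along the transition map gives the volume of the part of A lying in both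
chart domains. The inequality suffices to control the supremum of the chart volumes. -/
theorem chartVolume_inter_source_le (hφ : IsIsometricImmersion g φ) (p q : M) {A : Set M}
    (hA : MeasurableSet A) :
    chartVolume g q (A ∩ (chartAt (Euc m) p).source) ≤ chartVolume g p A := by
  rw [chartVolume_apply g q (hA.inter (chartAt (Euc m) p).open_source.measurableSet),
    chartVolume_apply g p hA]
  set c := chartAt (Euc m) p
  set c' := chartAt (Euc m) q
  have hc : c ∈ atlas (Euc m) M := chart_mem_atlas _ p
  have hc' : c' ∈ atlas (Euc m) M := chart_mem_atlas _ q
  set D := c'.target ∩ c'.symm ⁻¹' (A ∩ c.source) with hD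
  have hDm : MeasurableSet D :=
    measurableSet_target_inter_preimage c' (hA.inter c.open_source.measurableSet)
  have hDs : D ⊆ (c'.symm.trans c).source := fun z hz => by
    simpa using ⟨hz.1, hz.2.2⟩
  have hsub : (c'.symm.trans c).source ⊆ c'.target := fun z hz => by simp at hz; exact hz.1
  have hmem : ∀ z ∈ (c'.symm.trans c).source, c'.symm z ∈ c.source :=
    fun z hz => by simp at hz; exact hz.2
  have hG := isInducedMetric_gram hφ hc
  have hG' := (isInducedMetric_gram hφ hc').mono hsub (c'.symm.trans c).open_source
  have hT := contDiffOn_transition hc hc'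
  have hinj : Set.InjOn (fun z => c (c'.symm z)) D :=
    (c'.symm.trans c).injOn.mono hDs
  have hderiv : ∀ z ∈ D, HasFDerivWithinAt (fun z => c (c'.symm z))
      (fderiv ℝ (fun z => c (c'.symm z)) z) D z := fun z hz =>
    (hT.diffAt (c'.symm.trans c).open_source (hDs hz)).hasFDerivAt.hasFDerivWithinAt
  have h1 : ∫⁻ y in D, ENNReal.ofReal (volDensity g c' y)
      = ∫⁻ y in (fun z => c (c'.symm z)) '' D, ENNReal.ofReal (volDensity g c y) := by
    rw [lintegral_image_eq_lintegral_abs_det_fderiv_mul volume hDm hderiv hinj]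
    refine setLIntegral_congr_fun hDm fun z hz => ?_
    have := hG.density_comp hG' hT (fun z hz => c.map_source (hmem z hz))
      (fun z hz => by simp [c.left_inv (hmem z hz)]) (hDs hz)
    simp only [volDensity]
    rw [this, ENNReal.ofReal_mul (abs_nonneg _)]
  rw [h1]
  refine lintegral_mono_set ?_
  rintro _ ⟨z, hz, rfl⟩
  exact ⟨c.map_source hz.2.2, by simpa [c.left_inv hz.2.2] using hz.2.1⟩

/-- The Riemannian volume restricts to the coordinate volume on the domain of a chart. -/
theorem riemannianVolume_restrict (hφ : IsIsometricImmersion g φ) (p : M) :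
    (riemannianVolume g).restrict (chartAt (Euc m) p).source = chartVolume g p := by
  set S := (chartAt (Euc m) p).source with hS
  have hSm : MeasurableSet S := (chartAt (Euc m) p).open_source.measurableSet
  have h0 : (chartVolume g p) Sᶜ = 0 := by
    rw [chartVolume_apply g p hSm.compl]
    have : (chartAt (Euc m) p).target ∩ (chartAt (Euc m) p).symm ⁻¹' Sᶜ = ∅ := by
      ext z
      simp only [Set.mem_inter_iff, Set.mem_preimage, Set.mem_compl_iff, Set.mem_empty_iff_false,
        iff_false, not_and, not_not]
      exact fun hz => (chartAt (Euc m) p).map_target hz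
    rw [this]
    simp
  have hp : (chartVolume g p).restrict S = chartVolume g p :=
    Measure.restrict_eq_self_of_ae_mem (by rwa [Filter.Eventually, mem_ae_iff])
  apply le_antisymm
  · have h1 : riemannianVolume g ≤ chartVolume g p + (⊤ : Measure M).restrict Sᶜ := by
      refine iSup_le fun q => Measure.le_iff.2 fun A hA => ?_
      rw [← measure_inter_add_sdiff A hSm, Measure.add_apply, Measure.restrict_apply hA]
      refine add_le_add (chartVolume_inter_source_le hφ p q hA) ?_
      exact (le_top : chartVolume g q ≤ ⊤) _
    refine (Measure.restrict_mono' (Filter.Eventually.of_forall fun _ h => h) h1).trans ?_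
    rw [Measure.restrict_add, Measure.restrict_restrict hSm, hp]
    simp
  · rw [← hp]
    exact Measure.restrict_mono le_rfl (le_iSup (fun p => chartVolume g p) p)

/-- Integrals over a compact subset of a chart domain, in coordinates. -/
theorem setIntegral_riemannianVolume [T2Space M] (hφ : IsIsometricImmersion g φ) (p : M)
    {K : Set M} (hK : IsCompact K) (hKs : K ⊆ (chartAt (Euc m) p).source) {f : M → ℝ}
    (hf : Continuous f) :
    ∫ q in K, f q ∂(riemannianVolume g)
      = ∫ y in (chartAt (Euc m) p) '' K, √(gram g (chartAt (Euc m) p) y).det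
          * f ((chartAt (Euc m) p).symm y) := by
  set c := chartAt (Euc m) p with hc
  have hG := isInducedMetric_gram hφ (chart_mem_atlas (Euc m) p)
  rw [← Set.inter_eq_left.2 hKs, ← Measure.restrict_restrict hK.measurableSet,
    riemannianVolume_restrict hφ p, Set.inter_eq_left.2 hKs]
  simp only [chartVolume]
  rw [← hc]
  have hae := (aemeasurable_chart_symm c).mono_ac (withDensity_absolutelyContinuous
    ((volume : Measure (Euc m)).restrict c.target)
    (fun y => ENNReal.ofReal (volDensity g c y)))
  have hdens : AEMeasurable (fun y => ENNReal.ofReal (volDensity g c y))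
      ((volume : Measure (Euc m)).restrict c.target) :=
    (hG.contDiffOn_density.continuousOn.aemeasurable c.open_target.measurableSet).ennreal_ofReal
  rw [← integral_indicator hK.measurableSet, integral_map hae
    (hf.measurable.indicator hK.measurableSet).aestronglyMeasurable,
    integral_withDensity_eq_integral_toReal_smul₀ hdens
      (Filter.Eventually.of_forall fun _ => ENNReal.ofReal_lt_top)]
  have himg : c '' K = c.target ∩ c.symm ⁻¹' K := c.image_eq_target_inter_inv_preimage hKs
  have hmeas : MeasurableSet (c '' K) := by
    rw [himg]; exact measurableSet_target_inter_preimage c hK.measurableSet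
  have hsub : c '' K ⊆ c.target := by rw [himg]; exact Set.inter_subset_left
  rw [← integral_indicator hmeas, ← integral_indicator c.open_target.measurableSet]
  congr 1
  funext y
  by_cases hy : y ∈ c.target
  · rw [Set.indicator_of_mem hy]
    by_cases hyK : c.symm y ∈ K
    · have hy' : y ∈ c '' K := himg ▸ ⟨hy, hyK⟩
      rw [Set.indicator_of_mem hy', Set.indicator_of_mem hyK, ENNReal.toReal_ofReal
        (show 0 ≤ volDensity g c y from Real.sqrt_nonneg _)]
      rfl
    · have hy' : y ∉ c '' K := fun h => hyK (himg ▸ h).2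
      rw [Set.indicator_of_notMem hy', Set.indicator_of_notMem hyK, smul_zero]
  · rw [Set.indicator_of_notMem hy, Set.indicator_of_notMem fun h => hy (hsub h)]

end Volume

/-! ### Integration by parts and differentiation under the integral. -/

section Green

variable {m : ℕ} {F : Type*} [NormedAddCommGroup F] [InnerProductSpace ℝ F]
  {E : Type*} [NormedAddCommGroup E] [NormedSpace ℝ E] {Ω K : Set (Euc m)}

theorem pd_eq_zero_of_eqOn_diff {f : Euc m → E} (hΩ : IsOpen Ω) (hK : IsClosed K)
    (h0 : ∀ z ∈ Ω \ K, f z = 0) (i : Fin m) : ∀ z ∈ Ω \ K, pd i f z = 0 := fun z hz => by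
  rw [pd_congr_on (hΩ.sdiff hK) (h := fun _ => (0 : E)) h0 i hz, pd_const]

/-- The integral of a partial derivative of a function with compact support vanishes. -/
theorem setIntegral_pd_eq_zero {f : Euc m → ℝ} (hΩ : IsOpen Ω) (hK : IsCompact K) (hKΩ : K ⊆ Ω)
    (hf : ContDiffOn ℝ ∞ f Ω) (h0 : ∀ z ∈ Ω \ K, f z = 0) (i : Fin m) :
    IntegrableOn (pd i f) K ∧ ∫ z in K, pd i f z = 0 := by
  -- Extension by zero is smooth on ℝ^m because f vanishes on Ω outside the compact set K;
  -- integrating by parts against the constant 1 then gives the claim.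
  set H := Ω.indicator f with hH
  have hHf : Set.EqOn H f Ω := fun z hz => Set.indicator_of_mem hz f
  have hH0 : ∀ z ∉ K, H z = 0 := fun z hz => by
    by_cases hzΩ : z ∈ Ω
    · rw [hHf hzΩ, h0 z ⟨hzΩ, hz⟩]
    · exact Set.indicator_of_notMem hzΩ f
  have hHs : HasCompactSupport H := HasCompactSupport.intro hK hH0
  have hHd : ContDiff ℝ ∞ H := by
    refine contDiff_iff_contDiffAt.2 fun z => ?_
    by_cases hz : z ∈ Ω
    · exact (hf.contDiffAt (hΩ.mem_nhds hz)).congr_of_eventuallyEq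
        (hHf.eventuallyEq_of_mem (hΩ.mem_nhds hz))
    · have : H =ᶠ[𝓝 z] fun _ => 0 := by
        filter_upwards [hK.isClosed.isOpen_compl.mem_nhds fun h => hz (hKΩ h)] with w hw
        exact hH0 w hw
      exact contDiffAt_const.congr_of_eventuallyEq this
  have hpd : Continuous (pd i H) :=
    (hHd.continuous_fderiv (by simp)).clm_apply continuous_const
  have hpds : HasCompactSupport (pd i H) := hHs.fderiv_apply ℝ _
  have hint : Integrable (pd i H) := hpd.integrable_of_hasCompactSupport hpds
  have h1 : ∫ z, pd i H z = 0 := by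
    have := integral_mul_fderiv_eq_neg_fderiv_mul_of_integrable (μ := volume)
      (f := fun _ : Euc m => (1 : ℝ)) (g := H) (v := EuclideanSpace.single i 1)
      (by simp) (by simp only [one_mul]; exact hint)
      (by simpa using hHd.continuous.integrable_of_hasCompactSupport hHs)
      (fun _ _ => differentiableAt_const _) (fun _ _ => hHd.differentiable (by simp) _)
    simpa [pd] using this
  have h2 : Set.EqOn (pd i H) (pd i f) K := fun z hz => pd_congr_on hΩ hHf i (hKΩ hz)
  have h3 : ∀ z ∉ K, pd i H z = 0 := fun z hz =>
    pd_eq_zero_of_eqOn_diff (Ω := Set.univ) isOpen_univ hK.isClosed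
      (fun w hw => hH0 w hw.2) i z ⟨trivial, hz⟩
  refine ⟨hint.integrableOn.congr_fun h2 hK.measurableSet, ?_⟩
  rw [← setIntegral_congr_fun hK.measurableSet h2, setIntegral_eq_integral_of_forall_compl_eq_zero
    h3, h1]

namespace IsInducedMetric

variable {u : Euc m → F} {G : Euc m → Matrix (Fin m) (Fin m) ℝ} (hG : IsInducedMetric Ω u G)

include hG

/-- The right side is the divergence of √det g (⟨f, ∇w⟩ - ⟨∇f, w⟩); the products of first
derivatives cancel because G⁻¹ is symmetric. -/
theorem density_mul_inner_sub {f w : Euc m → F} (hf : ContDiffOn ℝ ∞ f Ω)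
    (hw : ContDiffOn ℝ ∞ w Ω) {y : Euc m} (hy : y ∈ Ω) :
    √(G y).det * inner ℝ (f y) (coordLaplacian G w y)
        - √(G y).det * inner ℝ (coordLaplacian G f y) (w y)
      = ∑ i, pd i (fun z => inner ℝ (f z) (∑ j, (√(G z).det * (G z)⁻¹ i j) • pd j w z)
        - inner ℝ (∑ j, (√(G z).det * (G z)⁻¹ i j) • pd j f z) (w z)) y := by
  have hY : ∀ {h : Euc m → F}, ContDiffOn ℝ ∞ h Ω → ∀ i,
      ContDiffOn ℝ ∞ (fun z => ∑ j, (√(G z).det * (G z)⁻¹ i j) • pd j h z) Ω := fun hh i =>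
    ContDiffOn.sum fun j _ => (hG.contDiffOn_coefficient i j).smul (hh.pd hG.isOpen j)
  have hL : ∀ h : Euc m → F, √(G y).det • coordLaplacian G h y
      = ∑ i, pd i (fun z => ∑ j, (√(G z).det * (G z)⁻¹ i j) • pd j h z) y := fun h => by
    rw [coordLaplacian, smul_inv_smul₀ (hG.density_pos hy).ne']
  have hd := hf.diffAt hG.isOpen hy
  have hd' := hw.diffAt hG.isOpen hy
  have h1 : ∀ i, pd i (fun z => inner ℝ (f z) (∑ j, (√(G z).det * (G z)⁻¹ i j) • pd j w z)
        - inner ℝ (∑ j, (√(G z).det * (G z)⁻¹ i j) • pd j f z) (w z)) y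
      = inner ℝ (f y) (pd i (fun z => ∑ j, (√(G z).det * (G z)⁻¹ i j) • pd j w z) y)
        - inner ℝ (pd i (fun z => ∑ j, (√(G z).det * (G z)⁻¹ i j) • pd j f z) y) (w y)
        + (∑ j, √(G y).det * (G y)⁻¹ i j * inner ℝ (pd i f y) (pd j w y)
        - ∑ j, √(G y).det * (G y)⁻¹ i j * inner ℝ (pd j f y) (pd i w y)) := by
    intro i
    have hw' := (hY hw i).diffAt hG.isOpen hy
    have hf' := (hY hf i).diffAt hG.isOpen hy
    rw [pd_sub i (hd.inner ℝ hw') (hf'.inner ℝ hd'), pd_inner i hd hw', pd_inner i hf' hd']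
    simp only [sum_inner, inner_sum, real_inner_smul_left, real_inner_smul_right]
    ring
  have h2 : ∑ i, ∑ j, √(G y).det * (G y)⁻¹ i j * inner ℝ (pd i f y) (pd j w y)
      = ∑ i, ∑ j, √(G y).det * (G y)⁻¹ i j * inner ℝ (pd j f y) (pd i w y) := by
    rw [Finset.sum_comm]
    refine Finset.sum_congr rfl fun i _ => Finset.sum_congr rfl fun j _ => ?_
    rw [hG.inv_symm hy]
  simp only [h1, Finset.sum_add_distrib, Finset.sum_sub_distrib, h2, sub_self, add_zero]
  rw [← inner_sum, ← sum_inner, ← hL, ← hL, real_inner_smul_left, real_inner_smul_right]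

/-- Green's identity for a pair of functions, one of which has compact support. -/
theorem green {f w : Euc m → F} (hf : ContDiffOn ℝ ∞ f Ω) (hw : ContDiffOn ℝ ∞ w Ω)
    (hK : IsCompact K) (hKΩ : K ⊆ Ω) (h0 : ∀ z ∈ Ω \ K, w z = 0) :
    ∫ z in K, (√(G z).det * inner ℝ (f z) (coordLaplacian G w z)
        - √(G z).det * inner ℝ (coordLaplacian G f z) (w z)) = 0 := by
  rw [setIntegral_congr_fun hK.measurableSet fun z hz =>
    hG.density_mul_inner_sub hf hw (hKΩ hz)]
  have hX : ∀ i, ContDiffOn ℝ ∞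
      (fun z => inner ℝ (f z) (∑ j, (√(G z).det * (G z)⁻¹ i j) • pd j w z)
        - inner ℝ (∑ j, (√(G z).det * (G z)⁻¹ i j) • pd j f z) (w z)) Ω := fun i =>
    (hf.inner ℝ (ContDiffOn.sum fun j _ =>
      (hG.contDiffOn_coefficient i j).smul (hw.pd hG.isOpen j))).sub
    ((ContDiffOn.sum fun j _ =>
      (hG.contDiffOn_coefficient i j).smul (hf.pd hG.isOpen j)).inner ℝ hw)
  have hX0 : ∀ i, ∀ z ∈ Ω \ K, inner ℝ (f z) (∑ j, (√(G z).det * (G z)⁻¹ i j) • pd j w z)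
        - inner ℝ (∑ j, (√(G z).det * (G z)⁻¹ i j) • pd j f z) (w z) = 0 := fun i z hz => by
    simp [h0 z hz, pd_eq_zero_of_eqOn_diff hG.isOpen hK.isClosed h0 _ z hz]
  have := fun i => setIntegral_pd_eq_zero hG.isOpen hK hKΩ (hX i) (hX0 i) i
  rw [integral_finsetSum _ fun i _ => (this i).1]
  exact Finset.sum_eq_zero fun i _ => (this i).2

end IsInducedMetric

/-- Differentiation of an integral over a compact set, for an integrand that depends smoothly on
the parameter and on finitely many continuous functions. -/
theorem hasDerivAt_setIntegral_comp {Z : Type*} [NormedAddCommGroup Z] [NormedSpace ℝ Z]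
    {h : ℝ × Z → ℝ} (hh : ContDiff ℝ ∞ h) {h' : Z → ℝ}
    (hh' : ∀ ζ, HasDerivAt (fun t => h (t, ζ)) (h' ζ) 0) (hK : IsCompact K) {κ : Euc m → Z}
    (hκ : ContinuousOn κ K) {ρ : Euc m → ℝ} (hρ : ContinuousOn ρ K) :
    HasDerivAt (fun t => ∫ y in K, ρ y * h (t, κ y)) (∫ y in K, ρ y * h' (κ y)) 0 := by
  set D : ℝ × Z → ℝ := fun x => fderiv ℝ h x (1, 0) with hD
  have hDc : Continuous D := (hh.continuous_fderiv (by simp)).clm_apply continuous_const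
  have hderiv : ∀ t ζ, HasDerivAt (fun t => h (t, ζ)) (D (t, ζ)) t := fun t ζ =>
    (hh.differentiable (by simp) (t, ζ)).hasFDerivAt.comp_hasDerivAt t
      ((hasDerivAt_id t).prodMk (hasDerivAt_const t ζ))
  have hD0 : ∀ ζ, D (0, ζ) = h' ζ := fun ζ => (hderiv 0 ζ).unique (hh' ζ)
  have hcont : ∀ t, ContinuousOn (fun y => ρ y * h (t, κ y)) K := fun t =>
    hρ.mul (hh.continuous.comp_continuousOn (continuousOn_const.prodMk hκ))
  have hcont' : ∀ t, ContinuousOn (fun y => ρ y * D (t, κ y)) K := fun t =>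
    hρ.mul (hDc.comp_continuousOn (continuousOn_const.prodMk hκ))
  -- The dominating function is a constant: the t-derivative of the integrand is bounded on the
  -- compact set [-1, 1] × K.
  obtain ⟨C, hC⟩ : ∃ C, ∀ x ∈ Metric.closedBall (0 : ℝ) 1 ×ˢ K, ‖ρ x.2 * D (x.1, κ x.2)‖ ≤ C := by
    refine ((isCompact_closedBall (0 : ℝ) 1).prod hK).exists_bound_of_continuousOn ?_
    have h2 : Set.MapsTo Prod.snd (Metric.closedBall (0 : ℝ) 1 ×ˢ K) K := fun x hx => hx.2
    exact (hρ.comp continuousOn_snd h2).mul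
      (hDc.comp_continuousOn (continuousOn_fst.prodMk (hκ.comp continuousOn_snd h2)))
  have := hasDerivAt_integral_of_dominated_loc_of_deriv_le (μ := volume.restrict K)
    (F := fun t y => ρ y * h (t, κ y)) (F' := fun t y => ρ y * D (t, κ y)) (x₀ := (0 : ℝ))
    (s := Metric.ball 0 1) (bound := fun _ => C) (Metric.ball_mem_nhds 0 one_pos)
    (Filter.Eventually.of_forall fun t =>
      (hcont t).aestronglyMeasurable hK.measurableSet)
    ((hcont 0).integrableOn_compact hK) ((hcont' 0).aestronglyMeasurable hK.measurableSet)
    ((ae_restrict_iff' hK.measurableSet).2 (Filter.Eventually.of_forall fun y hy t ht =>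
      hC (t, y) ⟨Metric.ball_subset_closedBall ht, hy⟩))
    (continuousOn_const.integrableOn_compact hK)
    (Filter.Eventually.of_forall fun y t _ => (hderiv t (κ y)).const_mul (ρ y))
  simpa only [hD0] using this.2

end Green

/-! ### The bienergy density of a variation and its derivative at t = 0. -/

section FirstVariation

variable {F : Type*} [NormedAddCommGroup F] [InnerProductSpace ℝ F]

theorem sphereProj_of_norm_eq_one {v : F} (hv : ‖v‖ = 1) (x : F) :
    sphereProj v x = x - (inner ℝ v x : ℝ) • v := by
  simp only [sphereProj, Submodule.starProjection_orthogonal']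
  simp [Submodule.starProjection_unit_singleton ℝ hv]

theorem norm_sphereProj_sq {v : F} (hv : ‖v‖ = 1) (x : F) :
    ‖sphereProj v x‖ ^ 2 = inner ℝ x x - inner ℝ v x ^ 2 := by
  rw [sphereProj_of_norm_eq_one hv, ← real_inner_self_eq_norm_sq]
  simp only [inner_sub_left, inner_sub_right, real_inner_smul_left, real_inner_smul_right,
    real_inner_self_eq_norm_sq, norm_smul, hv, real_inner_comm v x, Real.norm_eq_abs, mul_one,
    sq_abs]
  ring

/-- The square of the norm of the tension field of the variation
`(φ + t w) / √(1 + t² |w|²)` as a function of `t` and of derivatives of `φ` and `w`. -/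
def variationDensity (x : ℝ × F × F × F × F × F × F) : ℝ :=
  match x with
  | (t, a, b, c, d, u, w) =>
    (1 + t ^ 2 * inner ℝ w w)⁻¹ *
      (inner ℝ (a + t • b - (t ^ 2 * (1 + t ^ 2 * inner ℝ w w)⁻¹) • (c + t • d))
          (a + t • b - (t ^ 2 * (1 + t ^ 2 * inner ℝ w w)⁻¹) • (c + t • d))
        - (1 + t ^ 2 * inner ℝ w w)⁻¹ *
          inner ℝ (u + t • w)
            (a + t • b - (t ^ 2 * (1 + t ^ 2 * inner ℝ w w)⁻¹) • (c + t • d)) ^ 2)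

theorem one_add_sq_mul_inner_pos (t : ℝ) (w : F) : 0 < 1 + t ^ 2 * inner ℝ w w := by
  have : 0 ≤ t ^ 2 * inner ℝ w w := mul_nonneg (sq_nonneg t) real_inner_self_nonneg
  linarith

theorem contDiff_variationDensity : ContDiff ℝ ∞ (variationDensity (F := F)) := by
  have hD : ContDiff ℝ ∞ fun x : ℝ × F × F × F × F × F × F =>
      (1 + x.1 ^ 2 * inner ℝ x.2.2.2.2.2.2 x.2.2.2.2.2.2)⁻¹ :=
    ContDiff.inv (contDiff_const.add ((contDiff_fst.pow 2).mul (ContDiff.inner ℝ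
      (by fun_prop) (by fun_prop)))) fun x => (one_add_sq_mul_inner_pos _ _).ne'
  have hX : ContDiff ℝ ∞ fun x : ℝ × F × F × F × F × F × F =>
      x.2.1 + x.1 • x.2.2.1 - (x.1 ^ 2 * (1 + x.1 ^ 2 * inner ℝ x.2.2.2.2.2.2 x.2.2.2.2.2.2)⁻¹)
        • (x.2.2.2.1 + x.1 • x.2.2.2.2.1) :=
    ContDiff.sub (by fun_prop) (ContDiff.smul ((contDiff_fst.pow 2).mul hD) (by fun_prop))
  exact hD.mul ((hX.inner ℝ hX).sub (hD.mul ((ContDiff.inner ℝ (by fun_prop) hX).pow 2)))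

/-- In the application a = Δu and b = Δw, while c and d pair the gradient of |w|² with those of u
and w. The terms in c and d carry a factor t² and do not contribute at t = 0. -/
theorem hasDerivAt_variationDensity (a b c d u w : F) :
    HasDerivAt (fun t => variationDensity (t, a, b, c, d, u, w))
      (2 * inner ℝ a b - 2 * inner ℝ u a * (inner ℝ w a + inner ℝ u b)) 0 := by
  have hD : HasDerivAt (fun t : ℝ => (1 + t ^ 2 * inner ℝ w w)⁻¹) 0 0 := by
    have := (((hasDerivAt_pow 2 (0 : ℝ)).mul_const (inner ℝ w w)).const_add 1).fun_inv
      (by simp)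
    simpa using this
  have hid := hasDerivAt_id (0 : ℝ)
  have hX : HasDerivAt (fun t : ℝ => a + t • b
      - (t ^ 2 * (1 + t ^ 2 * inner ℝ w w)⁻¹) • (c + t • d)) b 0 := by
    have h1 := (hid.smul_const b).const_add a
    have h2 := (hid.smul_const d).const_add c
    have h3 := ((hasDerivAt_pow 2 (0 : ℝ)).mul hD).smul h2
    exact (h1.sub h3).congr_deriv (by simp)
  have hU : HasDerivAt (fun t : ℝ => u + t • w) w 0 := by
    simpa using (hid.smul_const w).const_add u
  have := hD.mul ((hX.inner ℝ hX).sub (hD.mul ((hU.inner ℝ hX).pow 2)))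
  exact this.congr_deriv (by simp [real_inner_comm a b]; ring)

end FirstVariation

/-! ### The Laplacian of a normalized variation. -/

section NormalizedVariation

variable {m : ℕ} {F : Type*} [NormedAddCommGroup F] [InnerProductSpace ℝ F] {Ω : Set (Euc m)}
  {y : Euc m}

/-- The factor that normalizes `u + t w` for a unit vector `u` and `w ⟂ u`. -/
def normFactor (t : ℝ) (w : F) : ℝ := (√(1 + t ^ 2 * inner ℝ w w))⁻¹

theorem normFactor_sq (t : ℝ) (w : F) : normFactor t w ^ 2 = (1 + t ^ 2 * inner ℝ w w)⁻¹ := by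
  rw [normFactor, inv_pow, Real.sq_sqrt (one_add_sq_mul_inner_pos t w).le]

theorem normFactor_sq_mul (t : ℝ) (w : F) :
    normFactor t w ^ 2 * (1 + t ^ 2 * inner ℝ w w) = 1 := by
  rw [normFactor_sq, inv_mul_cancel₀ (one_add_sq_mul_inner_pos t w).ne']

theorem contDiff_normFactor : ContDiff ℝ ∞ fun x : ℝ × F => normFactor x.1 x.2 :=
  ContDiff.inv (ContDiff.sqrt (contDiff_const.add ((contDiff_fst.pow 2).mul
    (contDiff_snd.inner ℝ contDiff_snd))) fun _ => (one_add_sq_mul_inner_pos _ _).ne')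
    fun _ => (Real.sqrt_pos.2 (one_add_sq_mul_inner_pos _ _)).ne'

theorem inner_add_smul_self {u w : F} (hu : ‖u‖ = 1) (huw : inner ℝ u w = 0) (t : ℝ) :
    inner ℝ (u + t • w) (u + t • w) = 1 + t ^ 2 * inner ℝ w w := by
  simp only [inner_add_left, inner_add_right, real_inner_smul_left, real_inner_smul_right, huw,
    real_inner_comm u w, real_inner_self_eq_norm_sq u, hu]
  ring

theorem norm_normFactor_smul {u w : F} (hu : ‖u‖ = 1) (huw : inner ℝ u w = 0) (t : ℝ) :
    ‖normFactor t w • (u + t • w)‖ = 1 := by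
  have h : ‖normFactor t w • (u + t • w)‖ ^ 2 = 1 := by
    rw [← real_inner_self_eq_norm_sq, real_inner_smul_left, real_inner_smul_right,
      inner_add_smul_self hu huw, ← mul_assoc, ← sq, normFactor_sq_mul]
  exact (pow_eq_one_iff_of_nonneg (norm_nonneg _) two_ne_zero).1 h

/-- Differentiate s²(1 + t²|w|²) = 1 rather than the square root. -/
theorem pd_normFactor {w : Euc m → F} (hw : DifferentiableAt ℝ w y) (t : ℝ) (i : Fin m) :
    pd i (fun z => normFactor t (w z)) y
      = -(t ^ 2 / 2 * normFactor t (w y) ^ 3) * pd i (fun z => inner ℝ (w z) (w z)) y := by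
  have hs : DifferentiableAt ℝ (fun z => normFactor t (w z)) y :=
    DifferentiableAt.comp y (g := fun x : ℝ × F => normFactor x.1 x.2)
      (contDiff_normFactor.differentiable (by simp) _) ((differentiableAt_const t).prodMk hw)
  have hq : DifferentiableAt ℝ (fun z => inner ℝ (w z) (w z)) y := hw.inner ℝ hw
  have hD : DifferentiableAt ℝ (fun z => 1 + t ^ 2 * inner ℝ (w z) (w z)) y :=
    (differentiableAt_const _).add ((differentiableAt_const _).mul hq)
  have h1 : pd i (fun z => normFactor t (w z) * (normFactor t (w z)
      * (1 + t ^ 2 * inner ℝ (w z) (w z)))) y = 0 := by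
    rw [pd_congr i (h := fun _ => (1 : ℝ)) (Filter.Eventually.of_forall fun z => by
      simp only [← mul_assoc, ← sq, normFactor_sq_mul]), pd_const]
  have h2 : pd i (fun z => 1 + t ^ 2 * inner ℝ (w z) (w z)) y
      = t ^ 2 * pd i (fun z => inner ℝ (w z) (w z)) y := by
    rw [pd_add i (differentiableAt_const _) ((differentiableAt_const _).fun_mul hq),
      pd_mul i (differentiableAt_const _) hq, pd_const, pd_const]
    ring
  have h3 := normFactor_sq_mul t (w y)
  rw [pd_mul i hs (hs.fun_mul hD), pd_mul i hs hD, h2] at h1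
  generalize pd i (fun z => normFactor t (w z)) y = a at *
  generalize pd i (fun z => inner ℝ (w z) (w z)) y = b at *
  generalize inner ℝ (w y) (w y) = q at *
  generalize normFactor t (w y) = s at *
  linear_combination (s / 2) * h1 - a * h3

/-- The square of the norm of the tension field of a normalized variation. -/
theorem IsInducedMetric.variationDensity_eq {u : Euc m → F}
    {G : Euc m → Matrix (Fin m) (Fin m) ℝ} (hG : IsInducedMetric Ω u G) {w : Euc m → F}
    (hw : ContDiffOn ℝ ∞ w Ω) (hu : ∀ z ∈ Ω, ‖u z‖ = 1) (huw : ∀ z ∈ Ω, inner ℝ (u z) (w z) = 0)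
    (t : ℝ) (hy : y ∈ Ω) {L v : F}
    (hL : L = coordLaplacian G (fun z => normFactor t (w z) • (u z + t • w z)) y)
    (hv : v = normFactor t (w y) • (u y + t • w y)) :
    inner ℝ L L - inner ℝ v L ^ 2 = variationDensity (t, coordLaplacian G u y,
      coordLaplacian G w y,
      gradProduct G (ContinuousLinearMap.lsmul ℝ ℝ) (fun z => inner ℝ (w z) (w z)) u y,
      gradProduct G (ContinuousLinearMap.lsmul ℝ ℝ) (fun z => inner ℝ (w z) (w z)) w y,
      u y, w y) := by
  have hsm : ContDiffOn ℝ ∞ (fun z => normFactor t (w z)) Ω :=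
    contDiff_normFactor.comp_contDiffOn (contDiffOn_const.prodMk hw)
  have htw : ContDiffOn ℝ ∞ (fun z => t • w z) Ω := contDiffOn_const.smul hw
  have hLt : coordLaplacian G (fun z => t • w z) y = t • coordLaplacian G w y :=
    hG.coordLaplacian_clm (t • ContinuousLinearMap.id ℝ F) hw hy
  have hpt : ∀ j, pd j (fun z => u z + t • w z) y = pd j u y + t • pd j w y := fun j => by
    rw [pd_add j (hG.smooth.diffAt hG.isOpen hy) (htw.diffAt hG.isOpen hy)]
    congr 1
    exact pd_clm (t • ContinuousLinearMap.id ℝ F) j (hw.diffAt hG.isOpen hy)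
  set s := normFactor t (w y) with hs
  set q : Euc m → ℝ := fun z => inner ℝ (w z) (w z) with hq
  set C := gradProduct G (ContinuousLinearMap.lsmul ℝ ℝ) q u y with hC
  set D := gradProduct G (ContinuousLinearMap.lsmul ℝ ℝ) q w y with hD
  have hgrad : gradProduct G (ContinuousLinearMap.lsmul ℝ ℝ) (fun z => normFactor t (w z))
      (fun z => u z + t • w z) y = (-(t ^ 2 / 2 * s ^ 3)) • (C + t • D) := by
    simp only [hC, hD, gradProduct, Finset.smul_sum, ← Finset.sum_add_distrib, hpt,
      pd_normFactor (hw.diffAt hG.isOpen hy), ContinuousLinearMap.lsmul_apply]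
    refine Finset.sum_congr rfl fun i _ => Finset.sum_congr rfl fun j _ => ?_
    module
  have hs2 : s ^ 2 = (1 + t ^ 2 * inner ℝ (w y) (w y))⁻¹ := normFactor_sq t (w y)
  have hsD : s ^ 2 * inner ℝ (u y + t • w y) (u y + t • w y) = 1 := by
    rw [inner_add_smul_self (hu y hy) (huw y hy), normFactor_sq_mul]
  set x := coordLaplacian G u y + t • coordLaplacian G w y - (t ^ 2 * s ^ 2) • (C + t • D) with hx
  -- The term containing the Laplacian of the normalizing factor is a multiple of v. The projection
  -- onto v^⊥ kills it, so it does not appear in `variationDensity`.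
  have hLx : L = coordLaplacian G (fun z => normFactor t (w z)) y • (u y + t • w y) + s • x := by
    rw [hL, hG.coordLaplacian_smul hsm (hG.smooth.add htw) hy, hgrad,
      hG.coordLaplacian_add hG.smooth htw hy, hLt, hx]
    module
  simp only [variationDensity]
  rw [← hs2, ← hx, hLx, hv]
  generalize coordLaplacian G (fun z => normFactor t (w z)) y = σ
  generalize u y + t • w y = e at *
  simp only [inner_add_left, inner_add_right, real_inner_smul_left, real_inner_smul_right,
    real_inner_comm e x]
  generalize inner ℝ e e = E at *
  generalize inner ℝ e x = X at *
  generalize inner ℝ x x = Y at *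
  linear_combination (-σ ^ 2 * E - 2 * σ * s * X) * hsD

end NormalizedVariation

/-! ### The Euler-Lagrange equation of the bienergy. -/

section EulerLagrange

variable {m : ℕ} {M : Type*} {F : Type*} [NormedAddCommGroup F] [InnerProductSpace ℝ F]
  {φ W : M → F}

/-- The variation `(φ + t W) / |φ + t W|` of a map `φ` into the unit sphere by a tangent field. -/
def normalizedVariation (φ W : M → F) (t : ℝ) (p : M) : F :=
  normFactor t (W p) • (φ p + t • W p)

theorem norm_normalizedVariation (h1 : ∀ p, ‖φ p‖ = 1) (hφW : ∀ p, inner ℝ (φ p) (W p) = 0)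
    (t : ℝ) (p : M) : ‖normalizedVariation φ W t p‖ = 1 :=
  norm_normFactor_smul (h1 p) (hφW p) t

variable [TopologicalSpace M] [ChartedSpace (Euc m) M]

theorem contMDiff_normalizedVariation_uncurry (hφ : ContMDiff (𝓡 m) 𝓘(ℝ, F) ∞ φ)
    (hW : ContMDiff (𝓡 m) 𝓘(ℝ, F) ∞ W) :
    ContMDiff (𝓘(ℝ, ℝ).prod (𝓡 m)) 𝓘(ℝ, F) ∞
      (fun q : ℝ × M => normalizedVariation φ W q.1 q.2) := by
  have h : ContDiff ℝ ∞ fun x : ℝ × F × F => normFactor x.1 x.2.2 • (x.2.1 + x.1 • x.2.2) :=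
    (contDiff_normFactor.comp (contDiff_fst.prodMk contDiff_snd.snd)).smul (by fun_prop)
  exact h.contMDiff.comp (contMDiff_fst.prodMk_space
    ((hφ.comp contMDiff_snd).prodMk_space (hW.comp contMDiff_snd)))

theorem contMDiff_normalizedVariation (hφ : ContMDiff (𝓡 m) 𝓘(ℝ, F) ∞ φ)
    (hW : ContMDiff (𝓡 m) 𝓘(ℝ, F) ∞ W) (t : ℝ) :
    ContMDiff (𝓡 m) 𝓘(ℝ, F) ∞ (normalizedVariation φ W t) :=
  (contMDiff_normalizedVariation_uncurry hφ hW).comp (contMDiff_const.prodMk contMDiff_id)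

theorem isSphereVariation_normalizedVariation (hφ : ContMDiff (𝓡 m) 𝓘(ℝ, F) ∞ φ)
    (hW : ContMDiff (𝓡 m) 𝓘(ℝ, F) ∞ W) (h1 : ∀ p, ‖φ p‖ = 1)
    (hφW : ∀ p, inner ℝ (φ p) (W p) = 0) {K : Set M} (h0 : ∀ p ∉ K, W p = 0) :
    IsSphereVariation (m := m) φ K (normalizedVariation φ W) :=
  ⟨contMDiff_normalizedVariation_uncurry hφ hW, norm_normalizedVariation h1 hφW,
    fun p => by simp [normalizedVariation, normFactor],
    fun t p hp => by simp [normalizedVariation, normFactor, h0 p hp]⟩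

variable [IsManifold (𝓡 m) ∞ M]

theorem norm_tension_sq {g : Metric m M} (hφ : IsIsometricImmersion g φ) {v : M → F}
    (hv : ContMDiff (𝓡 m) 𝓘(ℝ, F) ∞ v) (h1 : ∀ p, ‖v p‖ = 1) (p : M) :
    ‖tension g v p‖ ^ 2
      = inner ℝ (laplacian g v p) (laplacian g v p) - inner ℝ (v p) (laplacian g v p) ^ 2 := by
  rw [tension_eq_sphereProj hφ hv h1, norm_sphereProj_sq (h1 p)]

variable [T2Space M] [MeasurableSpace M] [BorelSpace M]

/-- The weak form of the biharmonic equation, for a test field supported in a chart. -/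
theorem setIntegral_inner_bitension_eq_zero {g : Metric m M} (hφ : IsIsometricImmersion g φ)
    (hb : IsBiharmonicToSphere g φ) (p : M) {K : Set M} (hK : IsCompact K)
    (hKs : K ⊆ (chartAt (Euc m) p).source) (hW : ContMDiff (𝓡 m) 𝓘(ℝ, F) ∞ W)
    (hφW : ∀ q, inner ℝ (φ q) (W q) = 0) (h0 : ∀ q ∉ K, W q = 0) :
    ∫ y in (chartAt (Euc m) p) '' K, √(gram g (chartAt (Euc m) p) y).det
      * inner ℝ (laplacian g (laplacian g φ) ((chartAt (Euc m) p).symm y)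
          + (2 * m : ℝ) • laplacian g φ ((chartAt (Euc m) p).symm y))
        (W ((chartAt (Euc m) p).symm y)) = 0 := by
  have hv := hb.2.2 K _ hK (isSphereVariation_normalizedVariation hφ.1 hW hb.2.1 hφW h0)
  set c := chartAt (Euc m) p with hc_def
  have hc : c ∈ atlas (Euc m) M := chart_mem_atlas _ p
  have hG := isInducedMetric_gram hφ hc
  set G := gram g c with hGdef
  set u : Euc m → F := fun z => φ (c.symm z) with hu
  set w : Euc m → F := fun z => W (c.symm z) with hw
  have hws : ContDiffOn ℝ ∞ w c.target := hW.comp_chart_symm hc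
  have hu1 : ∀ z ∈ c.target, ‖u z‖ = 1 := fun z _ => hb.2.1 _
  have huw : ∀ z ∈ c.target, inner ℝ (u z) (w z) = 0 := fun z _ => hφW _
  have himg : c '' K = c.target ∩ c.symm ⁻¹' K := c.image_eq_target_inter_inv_preimage hKs
  have hsub : c '' K ⊆ c.target := by rw [himg]; exact Set.inter_subset_left
  have hKc : IsCompact (c '' K) := hK.image_of_continuousOn (c.continuousOn.mono hKs)
  have hw0 : ∀ z ∈ c.target \ (c '' K), w z = 0 := fun z hz =>
    h0 _ fun h => hz.2 (himg ▸ ⟨hz.1, h⟩)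
  -- These are the arguments of the density that depend on the point but not on t.
  set κ : Euc m → F × F × F × F × F × F := fun y => (coordLaplacian G u y, coordLaplacian G w y,
      gradProduct G (ContinuousLinearMap.lsmul ℝ ℝ) (fun z => inner ℝ (w z) (w z)) u y,
      gradProduct G (ContinuousLinearMap.lsmul ℝ ℝ) (fun z => inner ℝ (w z) (w z)) w y,
      u y, w y) with hκ
  have hL := hG.contDiffOn_coordLaplacian hG.smooth
  have hκc : ContinuousOn κ (c '' K) :=
    ContinuousOn.mono (hL.continuousOn.prodMk
      ((hG.contDiffOn_coordLaplacian hws).continuousOn.prodMk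
      ((hG.contDiffOn_gradProduct _ (hws.inner ℝ hws) hG.smooth).continuousOn.prodMk
      ((hG.contDiffOn_gradProduct _ (hws.inner ℝ hws) hws).continuousOn.prodMk
      (hG.smooth.continuousOn.prodMk hws.continuousOn))))) hsub
  have henergy : ∀ t, bienergy g K (normalizedVariation φ W t)
      = (1 / 2) * ∫ y in c '' K, √(G y).det * variationDensity (t, κ y) := by
    intro t
    have hs := contMDiff_normalizedVariation hφ.1 hW t
    have h1 := norm_normalizedVariation hb.2.1 hφW t
    have hcont : Continuous fun q => ‖tension g (normalizedVariation φ W t) q‖ ^ 2 := by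
      simp only [norm_tension_sq hφ hs h1]
      have hl := (contMDiff_laplacian hφ hs).continuous
      exact (hl.inner hl).sub ((hs.continuous.inner hl).pow 2)
    rw [bienergy, setIntegral_riemannianVolume hφ p hK hKs hcont]
    congr 1
    refine setIntegral_congr_fun hKc.measurableSet fun y hy => ?_
    congr 1
    have hy' := hsub hy
    rw [norm_tension_sq hφ hs h1]
    refine hG.variationDensity_eq hws hu1 huw t hy' ?_ rfl
    exact laplacian_comp_symm hφ hc hs hy'
  have hd := (hasDerivAt_setIntegral_comp (contDiff_variationDensity (F := F))
    (h' := fun ζ => 2 * inner ℝ ζ.1 ζ.2.1 - 2 * inner ℝ ζ.2.2.2.2.1 ζ.1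
      * (inner ℝ ζ.2.2.2.2.2 ζ.1 + inner ℝ ζ.2.2.2.2.1 ζ.2.1))
    (fun ζ => hasDerivAt_variationDensity ζ.1 ζ.2.1 ζ.2.2.1 ζ.2.2.2.1 ζ.2.2.2.2.1 ζ.2.2.2.2.2)
    hKc hκc (hG.contDiffOn_density.continuousOn.mono hsub)).const_mul (1 / 2)
  rw [funext henergy] at hv
  have h2 := hd.unique hv
  have hg1 := hG.green hL hws hKc hsub hw0
  have hg2 := hG.green hG.smooth hws hKc hsub hw0
  have hρ := hG.contDiffOn_density.continuousOn.mono hsub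
  have hu' := hG.smooth.continuousOn.mono hsub
  have hw' := hws.continuousOn.mono hsub
  have hLu := hL.continuousOn.mono hsub
  have hLw := (hG.contDiffOn_coordLaplacian hws).continuousOn.mono hsub
  have hLLu := (hG.contDiffOn_coordLaplacian hL).continuousOn.mono hsub
  have i1 : IntegrableOn (fun z => √(G z).det * inner ℝ (coordLaplacian G u z)
      (coordLaplacian G w z) - √(G z).det * inner ℝ (coordLaplacian G (coordLaplacian G u) z)
      (w z)) (c '' K) :=
    ((hρ.mul (hLu.inner hLw)).sub (hρ.mul (hLLu.inner hw'))).integrableOn_compact hKc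
  have i2 : IntegrableOn (fun z => √(G z).det * inner ℝ (u z) (coordLaplacian G w z)
      - √(G z).det * inner ℝ (coordLaplacian G u z) (w z)) (c '' K) :=
    ((hρ.mul (hu'.inner hLw)).sub (hρ.mul (hLu.inner hw'))).integrableOn_compact hKc
  have i3 : IntegrableOn (fun z => √(G z).det * (2 * inner ℝ (coordLaplacian G u z)
      (coordLaplacian G w z) - 2 * inner ℝ (u z) (coordLaplacian G u z)
      * (inner ℝ (w z) (coordLaplacian G u z) + inner ℝ (u z) (coordLaplacian G w z))))
      (c '' K) :=
    (hρ.mul ((continuousOn_const.mul (hLu.inner hLw)).sub ((continuousOn_const.mul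
      (hu'.inner hLu)).mul ((hw'.inner hLu).add (hu'.inner hLw))))).integrableOn_compact hKc
  -- As ⟨u, Δu⟩ = -m, half the derivative has integrand ⟨Δu, Δw⟩ + m⟨Δu, w⟩ + m⟨u, Δw⟩ against the
  -- volume. Green's identity for the pair (Δu, w), and m times that for (u, w), move Δ off w and
  -- leave ⟨Δ²u + 2mΔu, w⟩.
  have key := congrArg₂ (· - ·) (congrArg₂ (· - ·) h2 hg1) (congrArg (fun r => (m : ℝ) * r) hg2)
  simp only [hκ] at key
  rw [← integral_const_mul, ← integral_const_mul, ← integral_sub (i3.const_mul _) i1,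
    ← integral_sub (Integrable.sub' (i3.const_mul _) i1) (i2.const_mul _)] at key
  refine Eq.trans (setIntegral_congr_fun hKc.measurableSet fun y hy => ?_)
    (key.trans (by simp))
  have hy' := hsub hy
  have e1 : laplacian g φ (c.symm y) = coordLaplacian G u y := laplacian_comp_symm hφ hc hφ.1 hy'
  have e2 : laplacian g (laplacian g φ) (c.symm y) = coordLaplacian G (coordLaplacian G u) y :=
    (laplacian_comp_symm hφ hc (contMDiff_laplacian hφ hφ.1) hy').trans
      (hG.coordLaplacian_congr (laplacian_comp_symm hφ hc hφ.1) hy')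
  have e3 := hG.inner_coordLaplacian_self hu1 hy'
  rw [real_inner_comm] at e3
  simp only [e1, e2, e3, inner_add_left, real_inner_smul_left,
    real_inner_comm (coordLaplacian G u y) (w y)]
  ring

/-- A biharmonic isometric immersion satisfies the Euler-Lagrange equation of the bienergy. -/
theorem sphereProj_bitension_eq_zero {g : Metric m M} (hφ : IsIsometricImmersion g φ)
    (hb : IsBiharmonicToSphere g φ) (p : M) :
    sphereProj (φ p) (laplacian g (laplacian g φ) p + (2 * m : ℝ) • laplacian g φ p) = 0 := by
  set V : M → F := fun q => laplacian g (laplacian g φ) q + (2 * m : ℝ) • laplacian g φ q with hV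
  have hΔ := contMDiff_laplacian hφ hφ.1
  have hVs : ContMDiff (𝓡 m) 𝓘(ℝ, F) ∞ V := by
    have h : ContDiff ℝ ∞ fun x : F × F => x.1 + (2 * m : ℝ) • x.2 := by fun_prop
    exact h.contMDiff.comp ((contMDiff_laplacian hφ hΔ).prodMk_space hΔ)
  set X : M → F := fun q => V q - (inner ℝ (φ q) (V q) : ℝ) • φ q with hX
  have hXs : ContMDiff (𝓡 m) 𝓘(ℝ, F) ∞ X := by
    have h : ContDiff ℝ ∞ fun x : F × F => x.2 - (inner ℝ x.1 x.2 : ℝ) • x.1 :=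
      contDiff_snd.sub ((contDiff_fst.inner ℝ contDiff_snd).smul contDiff_fst)
    exact h.contMDiff.comp (hφ.1.prodMk_space hVs)
  have hφX : ∀ q, inner ℝ (φ q) (X q) = 0 := fun q => by
    simp [hX, inner_sub_right, real_inner_smul_right, hb.2.1]
  have hVX : ∀ q, inner ℝ (V q) (X q) = inner ℝ (X q) (X q) := fun q => by
    have : V q = X q + (inner ℝ (φ q) (V q) : ℝ) • φ q := by simp [hX]
    conv_lhs => rw [this, inner_add_left, real_inner_smul_left, hφX]
    simp
  rw [sphereProj_of_norm_eq_one (hb.2.1 p)]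
  change X p = 0
  -- The test field is a bump function times the tangential part X of V; since ⟨V, X⟩ = |X|², the
  -- integrand becomes nonnegative.
  obtain ⟨ζ⟩ : Nonempty (SmoothBumpFunction (𝓡 m) p) := inferInstance
  have hK : IsCompact (tsupport ζ) := ζ.hasCompactSupport
  have hKs : tsupport ζ ⊆ (chartAt (Euc m) p).source := ζ.tsupport_subset_chartAt_source
  have h := setIntegral_inner_bitension_eq_zero (W := fun q => ζ q • X q) hφ hb p hK hKs
    (ζ.contMDiff.smul hXs) (fun q => by rw [real_inner_smul_right, hφX, mul_zero])
    (fun q hq => by rw [image_eq_zero_of_notMem_tsupport hq, zero_smul])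
  set c := chartAt (Euc m) p with hc_def
  have hG := isInducedMetric_gram hφ (chart_mem_atlas (Euc m) p)
  have himg : c '' tsupport ζ = c.target ∩ c.symm ⁻¹' tsupport ζ :=
    c.image_eq_target_inter_inv_preimage hKs
  have hsub : c '' tsupport ζ ⊆ c.target := by rw [himg]; exact Set.inter_subset_left
  have hKc : IsCompact (c '' tsupport ζ) := hK.image_of_continuousOn (c.continuousOn.mono hKs)
  set e : Euc m → ℝ := fun y => √(gram g c y).det
    * (ζ (c.symm y) * inner ℝ (X (c.symm y)) (X (c.symm y))) with he
  have hcont : ContinuousOn e (c '' tsupport ζ) := by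
    refine (hG.contDiffOn_density.continuousOn.mono hsub).mul ?_
    have : Continuous fun q => ζ q * inner ℝ (X q) (X q) :=
      ζ.continuous.mul (hXs.continuous.inner hXs.continuous)
    exact this.comp_continuousOn (c.continuousOn_symm.mono hsub)
  have h' : ∫ y in c '' tsupport ζ, e y = 0 := by
    rw [← h]
    refine setIntegral_congr_fun hKc.measurableSet fun y _ => ?_
    simp only [he, real_inner_smul_right, ← hVX]
    rfl
  have hnn : ∀ y, 0 ≤ e y := fun y =>
    mul_nonneg (Real.sqrt_nonneg _) (mul_nonneg ζ.nonneg real_inner_self_nonneg)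
  have hae : e =ᵐ[volume.restrict (c '' tsupport ζ)] fun _ => 0 :=
    (integral_eq_zero_iff_of_nonneg hnn (hcont.integrableOn_compact hKc)).1 h'
  have hU : IsOpen (interior (c '' tsupport ζ)) := isOpen_interior
  have hmem : c p ∈ interior (c '' tsupport ζ) := by
    rw [mem_interior_iff_mem_nhds, himg]
    have hp := c.map_source (mem_chart_source (Euc m) p)
    refine Filter.inter_mem (c.open_target.mem_nhds hp) ?_
    refine (c.continuousAt_symm hp).preimage_mem_nhds ?_
    rw [c.left_inv (mem_chart_source (Euc m) p)]
    exact ζ.tsupport_mem_nhds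
  -- Vanishing almost everywhere becomes vanishing at every interior point by continuity, in
  -- particular at `c p`, where the bump function equals 1.
  have heq := Measure.eqOn_open_of_ae_eq (ae_restrict_of_ae_restrict_of_subset
    interior_subset hae) hU (hcont.mono interior_subset) continuousOn_const hmem
  simp only [he, c.left_inv (mem_chart_source (Euc m) p), ζ.eq_one, one_mul] at heq
  have h0 := (hG.density_pos (c.map_source (mem_chart_source (Euc m) p))).ne'
  exact inner_self_eq_zero.1 ((mul_eq_zero.1 heq).resolve_left h0)

end EulerLagrange

/-! ### Global identities and constancy of harmonic fields of constant norm. -/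

section Rigidity

variable {m : ℕ} {M : Type*} [TopologicalSpace M] [ChartedSpace (Euc m) M]
  {E F : Type*} [NormedAddCommGroup E] [NormedSpace ℝ E]
  [NormedAddCommGroup F] [InnerProductSpace ℝ F] {φ : M → F}

theorem sphereProj_self (v : F) : sphereProj v v = 0 := by
  rw [sphereProj, Submodule.starProjection_orthogonal_val,
    Submodule.starProjection_eq_self_iff.2 (Submodule.mem_span_singleton_self v), sub_self]

theorem mfderiv_clm_comp (hφ : ContMDiff (𝓡 m) 𝓘(ℝ, F) ∞ φ) (B : F →L[ℝ] E) (p : M)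
    (v : TangentSpace (𝓡 m) p) :
    mfderiv (𝓡 m) 𝓘(ℝ, E) (fun q => B (φ q)) p v = B (mfderiv (𝓡 m) 𝓘(ℝ, F) φ p v) := by
  have h := mfderiv_comp p (I' := 𝓘(ℝ, F)) (g := B) (f := φ)
    ((B.contMDiff (n := ∞)).contMDiffAt.mdifferentiableAt (by simp))
    (hφ.contMDiffAt.mdifferentiableAt (by simp))
  change mfderiv (𝓡 m) 𝓘(ℝ, E) (B ∘ φ) p v = _
  rw [h, ContinuousLinearMap.mfderiv_eq]
  rfl

variable [IsManifold (𝓡 m) ∞ M] {g : Metric m M}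

theorem laplacian_clm (hφ : IsIsometricImmersion g φ) (B : F →L[ℝ] E) (p : M) :
    laplacian g (fun q => B (φ q)) p = B (laplacian g φ p) :=
  (isInducedMetric_gram hφ (chart_mem_atlas (Euc m) p)).coordLaplacian_clm B
    (hφ.1.comp_chart_symm (chart_mem_atlas (Euc m) p))
    ((chartAt (Euc m) p).map_source (mem_chart_source _ p))

theorem inner_laplacian_self (hφ : IsIsometricImmersion g φ) (h1 : ∀ p, ‖φ p‖ = 1) (p : M) :
    inner ℝ (laplacian g φ p) (φ p) = -m := by
  have hc := chart_mem_atlas (Euc m) p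
  have hy := (chartAt (Euc m) p).map_source (mem_chart_source _ p)
  have := (isInducedMetric_gram hφ hc).inner_coordLaplacian_self (fun z _ => h1 _) hy
  rwa [(chartAt (Euc m) p).left_inv (mem_chart_source _ p)] at this

theorem laplacian_laplacian_eq (hφ : IsIsometricImmersion g φ)
    {c : OpenPartialHomeomorph M (Euc m)} (hc : c ∈ atlas (Euc m) M) :
    Set.EqOn (fun w => laplacian g (laplacian g φ) (c.symm w))
      (coordLaplacian (gram g c) (coordLaplacian (gram g c) fun w => φ (c.symm w))) c.target :=
  fun _ hy => (laplacian_comp_symm hφ hc (contMDiff_laplacian hφ hφ.1) hy).trans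
    ((isInducedMetric_gram hφ hc).coordLaplacian_congr (laplacian_comp_symm hφ hc hφ.1) hy)

theorem inner_laplacian_laplacian (hφ : IsIsometricImmersion g φ) (h1 : ∀ p, ‖φ p‖ = 1) (p : M) :
    inner ℝ (laplacian g (laplacian g φ) p) (φ p)
      = inner ℝ (laplacian g φ p) (laplacian g φ p) := by
  have hc := chart_mem_atlas (Euc m) p
  have hp := mem_chart_source (Euc m) p
  have hy := (chartAt (Euc m) p).map_source hp
  have h := (isInducedMetric_gram hφ hc).inner_coordLaplacian_coordLaplacian (fun z _ => h1 _) hy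
  have e1 := laplacian_comp_symm hφ hc hφ.1 hy
  have e2 := laplacian_laplacian_eq hφ hc hy
  simp only [(chartAt (Euc m) p).left_inv hp] at e1 e2 h
  rw [e1, e2, h]

theorem tension_eq_add (hφ : IsIsometricImmersion g φ) (h1 : ∀ p, ‖φ p‖ = 1) (p : M) :
    tension g φ p = laplacian g φ p + (m : ℝ) • φ p := by
  rw [tension_eq_sphereProj hφ hφ.1 h1, sphereProj_of_norm_eq_one (h1 p), real_inner_comm,
    inner_laplacian_self hφ h1, neg_smul, sub_neg_eq_add]

/-- A harmonic field of the form `Δφ + a φ` with constant norm is constant. -/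
theorem isLocallyConstant_laplacian_add (hφ : IsIsometricImmersion g φ) {a r : ℝ}
    (hΔ : ∀ p, laplacian g (laplacian g φ) p + a • laplacian g φ p = 0)
    (hn : ∀ p, inner ℝ (laplacian g φ p + a • φ p) (laplacian g φ p + a • φ p) = r) :
    IsLocallyConstant fun p => laplacian g φ p + a • φ p := by
  rw [IsLocallyConstant.iff_eventually_eq]
  intro p
  set c := chartAt (Euc m) p
  have hc : c ∈ atlas (Euc m) M := chart_mem_atlas _ p
  have hp : p ∈ c.source := mem_chart_source _ p
  have hG := isInducedMetric_gram hφ hc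
  set u : Euc m → F := fun w => φ (c.symm w) with hu
  set f : Euc m → F := fun w => coordLaplacian (gram g c) u w + a • u w with hf
  have hLs := hG.contDiffOn_coordLaplacian hG.smooth
  have hau : ContDiffOn ℝ ∞ (fun w => a • u w) c.target := contDiffOn_const.smul hG.smooth
  have hfs : ContDiffOn ℝ ∞ f c.target := hLs.add hau
  have hfe : ∀ z ∈ c.target, laplacian g φ (c.symm z) + a • φ (c.symm z) = f z := fun z hz => by
    exact congrArg (· + a • φ (c.symm z)) (laplacian_comp_symm hφ hc hφ.1 hz)
  have hLf : ∀ z ∈ c.target, coordLaplacian (gram g c) f z = 0 := fun z hz => by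
    have h1 : coordLaplacian (gram g c) (fun w => a • u w) z = a • coordLaplacian (gram g c) u z :=
      hG.coordLaplacian_clm (a • ContinuousLinearMap.id ℝ F) hG.smooth hz
    rw [hf, hG.coordLaplacian_add hLs hau hz, h1, ← hΔ (c.symm z)]
    congr 1
    · exact (laplacian_laplacian_eq hφ hc hz).symm
    · congr 1
      exact (laplacian_comp_symm hφ hc hφ.1 hz).symm
  -- Δ|f|² = 0 and Δf = 0 leave |∇f|² = 0.
  have hpd : ∀ z ∈ c.target, fderiv ℝ f z = 0 := fun z hz => by
    have h2 := hG.coordLaplacian_inner hfs hfs hz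
    rw [hG.coordLaplacian_const (e := r) (fun w hw => by rw [← hfe w hw, hn]) hz, hLf z hz,
      inner_zero_left, inner_zero_right] at h2
    have h3 := hG.pd_eq_zero_of_gradProduct hz (by linarith)
    ext v
    have hv : v = ∑ i, v i • (EuclideanSpace.single i (1 : ℝ) : Euc m) := by
      ext k
      simp [Pi.single_apply]
    rw [hv, map_sum]
    exact Finset.sum_eq_zero fun i _ => by
      rw [map_smul]
      exact (congrArg _ (h3 i)).trans (smul_zero _)
  -- The target of a chart may be disconnected, so the argument is confined to a ball.
  obtain ⟨ε, hε, hball⟩ := Metric.isOpen_iff.1 c.open_target (c p) (c.map_source hp)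
  have hnhds : c.source ∩ c ⁻¹' Metric.ball (c p) ε ∈ 𝓝 p :=
    Filter.inter_mem (c.open_source.mem_nhds hp)
      ((c.continuousAt hp).preimage_mem_nhds (Metric.ball_mem_nhds _ hε))
  filter_upwards [hnhds] with q hq
  have hconst := Metric.isOpen_ball.is_const_of_fderiv_eq_zero (𝕜 := ℝ)
    (convex_ball (c p) ε).isPreconnected
    (fun z hz => ((hfs.diffAt c.open_target (hball hz)).differentiableWithinAt))
    (fun z hz => hpd z (hball hz)) hq.2 (Metric.mem_ball_self hε)
  have e1 := hfe (c q) (c.map_source hq.1)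
  have e2 := hfe (c p) (c.map_source hp)
  rw [c.left_inv hq.1] at e1
  rw [c.left_inv hp] at e2
  rw [e1, e2, hconst]

end Rigidity

/-! ### Immersions into a hyperplane section of the sphere. -/

section Hyperplane

variable {n : ℕ}

/-- The projection of `ℝ^{n+1}` onto its first `n` coordinates. -/
def initProj (n : ℕ) : Euc (n + 1) →L[ℝ] Euc n :=
  LinearMap.toContinuousLinearMap
    { toFun := fun x => WithLp.toLp 2 fun i => x i.castSucc
      map_add' := fun _ _ => rfl
      map_smul' := fun _ _ => rfl }

theorem initProj_apply (x : Euc (n + 1)) (i : Fin n) : initProj n x i = x i.castSucc := rfl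

theorem inner_eq_initProj (x y : Euc (n + 1)) :
    inner ℝ x y = inner ℝ (initProj n x) (initProj n y) + x (Fin.last n) * y (Fin.last n) := by
  simp only [PiLp.inner_apply, Fin.sum_univ_castSucc, initProj_apply]
  simp [mul_comm]

theorem standardInclusion_initProj {x : Euc (n + 1)} (hx : x (Fin.last n) = 1 / √2) :
    standardInclusion n (initProj n x) = x := by
  ext i
  refine Fin.lastCases ?_ (fun j => ?_) i
  · simp [standardInclusion, hx]
  · simp [standardInclusion, initProj_apply]

/-- The reflection in the hyperplane orthogonal to the difference of two unit vectors exchanges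
them. -/
theorem exists_linearIsometryEquiv_last {e : Euc (n + 1)} (he : ‖e‖ = 1) :
    ∃ A : Euc (n + 1) ≃ₗᵢ[ℝ] Euc (n + 1), A (EuclideanSpace.single (Fin.last n) 1) = e :=
  ⟨_, Submodule.reflection_sub (by simp [he])⟩

variable {m : ℕ} {M : Type*} [TopologicalSpace M] [ChartedSpace (Euc m) M]
  [IsManifold (𝓡 m) ∞ M] {g : Metric m M} {φ : M → Euc (n + 1)}

/-- An isometric immersion into the unit sphere that lies in the hyperplane `⟨x, e⟩ = 1/√2` and
whose Laplacian is `√2 m e - 2 m φ` is the composition of a minimal immersion and the standard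
inclusion. -/
theorem exists_minimal_of_hyperplane (hφ : IsIsometricImmersion g φ) (h1 : ∀ p, ‖φ p‖ = 1)
    {e : Euc (n + 1)} (he : ‖e‖ = 1) (hφe : ∀ p, inner ℝ (φ p) e = 1 / √2) {a b : ℝ}
    (hΔ : ∀ p, laplacian g φ p = a • e + b • φ p) :
    ∃ (ψ : M → Euc n) (A : Euc (n + 1) ≃ₗᵢ[ℝ] Euc (n + 1)),
      IsMinimalInSphere g (1 / √2) ψ ∧ ∀ p, φ p = A (standardInclusion n (ψ p)) := by
  obtain ⟨A, hA⟩ := exists_linearIsometryEquiv_last he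
  set A' : Euc (n + 1) →L[ℝ] Euc (n + 1) :=
    A.symm.toContinuousLinearEquiv.toContinuousLinearMap with hA'
  have hA'a : ∀ x, A' x = A.symm x := fun x => rfl
  set B : Euc (n + 1) →L[ℝ] Euc n := (initProj n).comp A' with hB
  have hlast : ∀ x, (A' x) (Fin.last n) = inner ℝ x e := fun x => by
    have h : inner ℝ (A' x) (EuclideanSpace.single (Fin.last n) (1 : ℝ)) = inner ℝ x e := by
      rw [← hA, ← A.inner_map_map, hA'a, A.apply_symm_apply]
    rw [← h]
    simp [EuclideanSpace.inner_single_right]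
  -- B kills e and is isometric on e^⊥: it rotates e to the last basis vector and drops the last
  -- coordinate.
  have hinner : ∀ x y, inner ℝ (B x) (B y) = inner ℝ x y - inner ℝ x e * inner ℝ y e := by
    intro x y
    have h := inner_eq_initProj (A' x) (A' y)
    rw [hlast, hlast, hA'a, hA'a, A.symm.inner_map_map] at h
    rw [h]
    simp [hB, hA'a]
  have hBe : B e = 0 := by
    rw [← inner_self_eq_zero (𝕜 := ℝ), hinner, real_inner_self_eq_norm_sq, he]
    norm_num
  have hs : ContMDiff (𝓡 m) 𝓘(ℝ, Euc n) ∞ fun p => B (φ p) := B.contMDiff.comp hφ.1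
  have hnorm : ∀ p, ‖B (φ p)‖ = 1 / √2 := fun p => by
    have h : ‖B (φ p)‖ ^ 2 = (1 / √2) ^ 2 := by
      rw [← real_inner_self_eq_norm_sq, hinner, hφe, real_inner_self_eq_norm_sq, h1, ← sq,
        div_pow, Real.sq_sqrt zero_le_two]
      norm_num
    exact (pow_left_inj₀ (norm_nonneg _) (by positivity) two_ne_zero).1 h
  refine ⟨fun p => B (φ p), A, ⟨⟨hs, fun p v w => ?_⟩, hnorm, fun p => ?_⟩, fun p => ?_⟩
  -- ⟨φ, e⟩ is constant, so dφ takes values in e^⊥, where B preserves inner products.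
  · have hz : ∀ v, inner ℝ (E := Euc (n + 1)) (mfderiv (𝓡 m) 𝓘(ℝ, Euc (n + 1)) φ p v) e = 0 :=
      fun v => by
        have h0 : ∀ f : M → ℝ, (f = fun _ => 1 / √2) → mfderiv (𝓡 m) 𝓘(ℝ, ℝ) f p v = (0 : ℝ) := by
          rintro f rfl
          rw [mfderiv_const]
          rfl
        have h := mfderiv_clm_comp hφ.1 (realInnerCLM e) p v
        refine (real_inner_comm (F := Euc (n + 1)) _ _).trans ?_
        exact h.symm.trans (h0 _ (funext fun q => (real_inner_comm _ _).trans (hφe q)))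
    rw [mfderiv_clm_comp hφ.1, mfderiv_clm_comp hφ.1]
    refine (hinner _ _).trans ?_
    rw [hz, hz, mul_zero, sub_zero]
    exact hφ.2 p v w
  -- The Laplacian of Bφ is B(a e + bφ) = b Bφ. It is radial, so its tangential part vanishes
  -- whatever a and b are.
  · rw [meanCurvature, tension_eq_sphereProj hφ hs hnorm, laplacian_clm hφ, hΔ, map_add, map_smul,
      map_smul, hBe, smul_zero, zero_add, map_smul, sphereProj_self, smul_zero, smul_zero]
  · have h : standardInclusion n (B (φ p)) = A' (φ p) :=
      standardInclusion_initProj ((hlast _).trans (hφe p))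
    rw [h, hA'a, A.apply_symm_apply]

end Hyperplane

end Biharm

/-! ### The dichotomy and the conclusion. -/

open Biharm in
theorem theorem2p4 {m n : ℕ} (hm : 0 < m)
    {M : Type*} [TopologicalSpace M] [T2Space M] [SecondCountableTopology M] [ConnectedSpace M]
    [ChartedSpace (Biharm.Euc m) M] [IsManifold (𝓡 m) ∞ M]
    [MeasurableSpace M] [BorelSpace M]
    (g : Biharm.Metric m M) (φ : M → Biharm.Euc (n + 1)) (μ : M → ℝ)
    (hφ : Biharm.IsIsometricImmersion g φ)
    (hbuckling : ∀ p, Biharm.laplacian g (Biharm.laplacian g φ) p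
      = -(μ p) • Biharm.laplacian g φ p)
    (hbiharmonic : Biharm.IsBiharmonicToSphere g φ) :
    (Biharm.IsMinimalInSphere g 1 φ ∧ ∀ p, μ p = m) ∨
    ((∀ p, μ p = 2 * m) ∧ (∀ p, ‖Biharm.meanCurvature g φ p‖ = 1) ∧
      ∃ (ψ : M → Biharm.Euc n) (A : Biharm.Euc (n + 1) ≃ₗᵢ[ℝ] Biharm.Euc (n + 1)),
        Biharm.IsMinimalInSphere g (1 / √2) ψ ∧
        ∀ p, φ p = A (Biharm.standardInclusion n (ψ p))) := by
  have h1 := hbiharmonic.2.1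
  have hm0 : (0 : ℝ) < m := Nat.cast_pos.2 hm
  have hτ := tension_eq_add hφ h1
  have hself := inner_laplacian_self hφ h1
  have hLL : ∀ p, inner ℝ (laplacian g φ p) (laplacian g φ p) = μ p * m := fun p => by
    rw [← inner_laplacian_laplacian hφ h1, hbuckling, real_inner_smul_left, hself]
    ring
  have hnorm : ∀ p, ‖tension g φ p‖ ^ 2 = m * (μ p - m) := fun p => by
    rw [norm_tension_sq hφ hφ.1 h1, hLL, real_inner_comm, hself]
    ring
  -- Here Δ²φ + 2mΔφ = (2m - μ)Δφ, and τ is the tangential part of Δφ.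
  have hdich : ∀ p, (2 * m - μ p) • tension g φ p = 0 := fun p => by
    have h := sphereProj_bitension_eq_zero hφ hbiharmonic p
    rw [hbuckling, ← add_smul, map_smul, ← tension_eq_sphereProj hφ hφ.1 h1] at h
    rw [← h]
    congr 1
    ring
  have hval : ∀ p, tension g φ p ≠ 0 → μ p = 2 * m := fun p hp => by
    have := (smul_eq_zero.1 (hdich p)).resolve_right hp
    linarith
  -- Continuity is taken from |τ|², as μ is an arbitrary function.
  have hcont : Continuous fun p => ‖tension g φ p‖ ^ 2 := by
    simp only [hτ]
    exact (((contMDiff_laplacian hφ hφ.1).continuous.add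
      (hφ.1.continuous.const_smul (m : ℝ))).norm.pow 2)
  have hclopen : IsClopen {p | tension g φ p = 0} := by
    have e1 : {p | tension g φ p = 0} = {p | ‖tension g φ p‖ ^ 2 = 0} := by
      ext p
      simp
    -- Where τ ≠ 0, the value of |τ|² is exactly m², so the strict bound by m² cuts out the zero set
    -- and shows that it is open.
    have e2 : {p | tension g φ p = 0} = {p | ‖tension g φ p‖ ^ 2 < (m : ℝ) ^ 2} := by
      ext p
      refine ⟨fun h => ?_, fun h => ?_⟩
      · have h : tension g φ p = 0 := h
        change ‖tension g φ p‖ ^ 2 < (m : ℝ) ^ 2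
        rw [h, norm_zero, zero_pow two_ne_zero]
        positivity
      · by_contra h0
        have h : ‖tension g φ p‖ ^ 2 < (m : ℝ) ^ 2 := h
        rw [hnorm, hval p h0] at h
        linarith
    exact ⟨e1 ▸ isClosed_eq hcont continuous_const, e2 ▸ isOpen_lt hcont continuous_const⟩
  rcases isClopen_iff.1 hclopen with h0 | h0
  · right
    have hne : ∀ p, tension g φ p ≠ 0 := fun p hp => by
      have : p ∈ ({p | tension g φ p = 0} : Set M) := hp
      rw [h0] at this
      exact this
    have hμ := fun p => hval p (hne p)
    refine ⟨hμ, fun p => ?_, ?_⟩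
    · have h2 : ‖tension g φ p‖ ^ 2 = (m : ℝ) ^ 2 := by rw [hnorm, hμ]; ring
      have h3 := (pow_left_inj₀ (norm_nonneg _) hm0.le two_ne_zero).1 h2
      rw [meanCurvature, norm_smul, h3, norm_inv, Real.norm_of_nonneg hm0.le,
        inv_mul_cancel₀ hm0.ne']
    · set H : M → Euc (n + 1) := fun p => laplacian g φ p + (2 * m : ℝ) • φ p with hH
      -- With μ = 2m: |Δφ|² + 4m⟨Δφ, φ⟩ + 4m² = 2m² - 4m² + 4m².
      have hHn : ∀ p, inner ℝ (H p) (H p) = 2 * (m : ℝ) ^ 2 := fun p => by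
        simp only [hH, inner_add_left, inner_add_right, real_inner_smul_left,
          real_inner_smul_right, hLL, hself, real_inner_comm (laplacian g φ p) (φ p), hμ,
          real_inner_self_eq_norm_sq (φ p), h1]
        ring
      have hHc := isLocallyConstant_laplacian_add hφ (a := 2 * m)
        (fun p => by rw [hbuckling, hμ, ← add_smul]; simp) hHn
      obtain ⟨p₀⟩ : Nonempty M := inferInstance
      have hHp : ∀ p, H p = H p₀ := fun p => hHc.apply_eq_of_isPreconnected isPreconnected_univ
        (Set.mem_univ _) (Set.mem_univ _)
      have h2 : (√2 * m : ℝ) ≠ 0 := by positivity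
      have hs2 : √2 * √2 = (2 : ℝ) := Real.mul_self_sqrt zero_le_two
      -- The unit vector is H/|H| with |H| = √2 m. Since ⟨φ, H⟩ = -m + 2m = m, its product with φ is
      -- 1/√2; a and b are read off from Δφ = H - 2mφ.
      refine exists_minimal_of_hyperplane hφ h1 (e := (√2 * m : ℝ)⁻¹ • H p₀) (a := √2 * m)
        (b := -(2 * m)) ?_ (fun p => ?_) fun p => ?_
      · have h3 : ‖H p₀‖ ^ 2 = (√2 * m) ^ 2 := by
          rw [← real_inner_self_eq_norm_sq, hHn, mul_pow, sq √2, hs2]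
        have h4 := (pow_left_inj₀ (norm_nonneg _) (by positivity) two_ne_zero).1 h3
        rw [norm_smul, h4, norm_inv, Real.norm_of_nonneg (by positivity), inv_mul_cancel₀ h2]
      · rw [← hHp p, real_inner_smul_right]
        simp only [hH, inner_add_right, real_inner_smul_right, real_inner_self_eq_norm_sq, h1,
          real_inner_comm (laplacian g φ p) (φ p), hself]
        field_simp
        ring
      · rw [smul_inv_smul₀ h2, ← hHp p]
        simp [hH]
  · left
    have hz : ∀ p, tension g φ p = 0 := fun p => by
      have : p ∈ ({p | tension g φ p = 0} : Set M) := h0 ▸ Set.mem_univ p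
      exact this
    refine ⟨⟨hφ, h1, fun p => by rw [meanCurvature, hz, smul_zero]⟩, fun p => ?_⟩
    have h2 := hnorm p
    rw [hz, norm_zero] at h2
    have h3 := (mul_eq_zero.1 (h2.symm.trans (by norm_num))).resolve_left hm0.ne'
    linarith

end
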